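/- Let $0<\kappa<\nu$, $1<\gamma$, $T>0$, $\tau>0$, and set $\lambda=\sqrt{\nu^2-\kappa^2}$, $\mu=\nu-\sqrt{\nu^2-\kappa^2}$. Let $\mathbb T^3=\mathbb R^3/\mathbb Z^3$, let $Dv=\frac12(\nabla v+(\nabla v)^T)$ denote the symmetric part of the gradient, and let all spatial integrals be over $\mathbb T^3$. A *smooth solution* on $[0,T)\times\mathbb T^3$ is a pair $(\rho,u)$ of smooth functions with $\rho>0$ that satisfies $$\partial_t\rho+\operatorname{div}(\rho u)=0,$$ $$\partial_t(\rho u)+\operatorname{div}(\rho u\otimes u)+\nabla\rho^{\gamma}-2\nu\operatorname{div}(\rho Du)-2\kappa^2\rho\nabla\Big(\frac{\Delta\sqrt\rho}{\sqrt\rho}\Big)=0 .$$ (i) Let $(\rho,u)$ be a smooth solution and $w=u+\mu\nabla\log\rho$. Then, for every $t\in(0,T)$, $$\begin{aligned} &\frac{d}{dt}\int\rho\Big(1+\frac{|w|^2}{2}\Big)\log\Big(1+\frac{|w|^2}{2}\Big)dx+\mu\int\rho|\nabla w|^2dx+\mu\int\rho|\nabla w|^2\log\Big(1+\frac{|w|^2}{2}\Big)dx\\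 &\quad+2\lambda\int\rho|Dw|^2dx+2\lambda\int\rho|Dw|^2\log\Big(1+\frac{|w|^2}{2}\Big)dx+\mu\int\rho\Big|\nabla\frac{|w|^2}{2}\Big|^2\frac{2}{2+|w|^2}dx\\ &=-2\lambda\int\rho\sum_{i,j,k}(Dw)_{ij}\,w_i\,(\partial_jw_k)\,w_k\,\frac{2}{2+|w|^2}dx +\int\rho^\gamma\operatorname{div}w\Big(1+\log\Big(1+\frac{|w|^2}{2}\Big)\Big)dx\\ &\quad+\int\rho^\gamma\sum_{i,k}w_i\,(\partial_iw_k)\,w_k\,\frac{2}{2+|w|^2}dx , \end{aligned}$$ where the derivative on the left exists. (ii) Assume in addition $\gamma<3$. Let $\rho^0_n>0$ and $u^0_n$ be sequences of smooth functions and smooth vector fields on $\mathbb T^3$, and let $\rho^0\ge0$ and $u^0$ be a function and a vector field on $\mathbb T^3$, such that - $\{\rho^0_n\}$ is bounded in $L^1\cap L^\gamma$, and $\rho^0_n\to\rho^0$ in $L^1$; - $\{\nabla\sqrt{\rho^0_n}\}$ is bounded in $L^2\cap L^{2+\tau}$, and $\nabla\sqrt{\rho^0_n}\to\nabla\sqrt{\rho^0}$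 in $L^2$; - $\{\sqrt{\rho^0_n}\,u^0_n\}$ is bounded in $L^2\cap L^{2+\tau}$, and $\rho^0_nu^0_n\to\rho^0u^0$ in $L^1$; - with $w^0_n=u^0_n+\mu\nabla\log\rho^0_n$, the sequence $\rho^0_n\big(1+\tfrac{|w^0_n|^2}{2}\big)\log\big(1+\tfrac{|w^0_n|^2}{2}\big)$ is bounded in $L^1$. For every $n$ let $(\rho_n,u_n)$ be a smooth solution on $[0,T)\times\mathbb T^3$ with $\rho_n(0,\cdot)=\rho^0_n$ and $(\rho_nu_n)(0,\cdot)=\rho^0_nu^0_n$, and let $w_n=u_n+\mu\nabla\log\rho_n$. Then there is a constant $C>0$, independent of $n$, such that $$\sup_{t\in[0,T)}\int\rho_n\Big(1+\frac{|w_n|^2}{2}\Big)\log\Big(1+\frac{|w_n|^2}{2}\Big)dx\le C .$$ -/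

import Mathlib

open scoped ContDiff
open MeasureTheory Filter Topology

noncomputable section

namespace QNS

/-- The coordinate space `ℝ³`. Functions and vector fields on the flat torus `𝕋³ = ℝ³/ℤ³` are
functions on `Space` that have period `1` in each coordinate. -/
abbrev Space : Type := Fin 3 → ℝ

/-- Period `1` in each coordinate. -/
def Periodic {α : Type*} (f : Space → α) : Prop :=
  ∀ (x : Space) (i : Fin 3), f (x + Pi.single i 1) = f x

/-- The unit cube, a fundamental domain of the torus (up to a null set): an integral over `𝕋³` is
an integral over `cube`. -/
def cube : Set Space := Set.Icc 0 1

/-- The partial derivative `∂ᵢ f`. -/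
def pd (i : Fin 3) (f : Space → ℝ) (x : Space) : ℝ := fderiv ℝ f x (Pi.single i 1)

/-- The Laplacian. -/
def laplacian (f : Space → ℝ) (x : Space) : ℝ := ∑ i, pd i (pd i f) x

/-- The squared Euclidean length `|a|²` of a vector of `ℝ³`. -/
def normSq (a : Space) : ℝ := ∑ i, a i ^ 2

/-- The gradient `∇f`. -/
def grad (f : Space → ℝ) (x : Space) : Space := fun i => pd i f x

/-- The divergence `div v`. -/
def divergence (v : Space → Space) (x : Space) : ℝ := ∑ i, pd i (fun y => v y i) x

/-- The entry `∂ⱼ vᵢ` of the Jacobian matrix. -/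
def jac (v : Space → Space) (x : Space) (i j : Fin 3) : ℝ := pd j (fun y => v y i) x

/-- The symmetric part `Dv = (∇v + (∇v)ᵀ)/2` of the gradient. -/
def symGrad (v : Space → Space) (x : Space) (i j : Fin 3) : ℝ := (jac v x i j + jac v x j i) / 2

/-- `(ρ, u)` is a smooth solution with strictly positive density, on `[0, T) × 𝕋³`, of
`∂ₜρ + div(ρu) = 0`,
`∂ₜ(ρu) + div(ρ u⊗u) + ∇ρ^γ - 2ν div(ρ Du) - 2κ² ρ ∇(Δ√ρ/√ρ) = 0`. -/
structure IsSmoothSolution (ν κ γ T : ℝ) (ρ : ℝ → Space → ℝ) (u : ℝ → Space → Space) :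
    Prop where
  smooth_density :
    ContDiffOn ℝ ∞ (fun p : ℝ × Space => ρ p.1 p.2) (Set.Ico 0 T ×ˢ Set.univ)
  smooth_velocity :
    ContDiffOn ℝ ∞ (fun p : ℝ × Space => u p.1 p.2) (Set.Ico 0 T ×ˢ Set.univ)
  periodic_density : ∀ t ∈ Set.Ico 0 T, Periodic (ρ t)
  periodic_velocity : ∀ t ∈ Set.Ico 0 T, Periodic (u t)
  density_pos : ∀ t ∈ Set.Ico 0 T, ∀ x, 0 < ρ t x
  continuity_eq : ∀ t ∈ Set.Ioo 0 T, ∀ x,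
    deriv (fun s => ρ s x) t + divergence (fun y => ρ t y • u t y) x = 0
  momentum_eq : ∀ t ∈ Set.Ioo 0 T, ∀ x, ∀ i,
    deriv (fun s => ρ s x * u s x i) t
      + ∑ j, pd j (fun y => ρ t y * u t y i * u t y j) x
      + pd i (fun y => ρ t y ^ γ) x
      - 2 * ν * ∑ j, pd j (fun y => ρ t y * symGrad (u t) y i j) x
      - 2 * κ ^ 2 * ρ t x *
          pd i (fun y => laplacian (fun z => √(ρ t z)) y / √(ρ t y)) x = 0

/-- `λ = √(ν² - κ²)`. -/
def lam (ν κ : ℝ) : ℝ := √(ν ^ 2 - κ ^ 2)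

/-- `μ = ν - √(ν² - κ²)`. -/
def mu (ν κ : ℝ) : ℝ := ν - √(ν ^ 2 - κ ^ 2)

/-- The effective velocity `u + c ∇ log ρ`. -/
def effVelocity (c : ℝ) (ρ : Space → ℝ) (u : Space → Space) (x : Space) : Space :=
  fun i => u x i + c * pd i (fun y => Real.log (ρ y)) x

/-- `log (1 + |w|²/2)`. -/
def logTerm (w : Space → Space) (x : Space) : ℝ := Real.log (1 + normSq (w x) / 2)

/-- `∫ ρ (1 + |w|²/2) log (1 + |w|²/2) dx`. -/
def mvEntropy (ρ : Space → ℝ) (w : Space → Space) : ℝ :=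
  ∫ x in cube, ρ x * (1 + normSq (w x) / 2) * logTerm w x

/-- The vector field `G` is the distributional gradient of `f` on the torus. -/
def IsWeakGrad (f : Space → ℝ) (G : Space → Space) : Prop :=
  ∀ φ : Space → ℝ, ContDiff ℝ ∞ φ → Periodic φ → ∀ i,
    ∫ x in cube, f x * pd i φ x = -∫ x in cube, G x i * φ x

/-- The hypotheses on the sequence of initial densities `ρ₀ n` and on its limit `ρlim`. -/
structure InitialDensityHyp (γ τ : ℝ) (ρ₀ : ℕ → Space → ℝ) (ρlim : Space → ℝ) : Prop where
  smooth : ∀ n, ContDiff ℝ ∞ (ρ₀ n)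
  periodic : ∀ n, Periodic (ρ₀ n)
  pos : ∀ n x, 0 < ρ₀ n x
  lim_nonneg : ∀ᵐ x ∂volume.restrict cube, 0 ≤ ρlim x
  lim_integrable : IntegrableOn ρlim cube
  tendsto_L1 : Tendsto (fun n => ∫ x in cube, |ρ₀ n x - ρlim x|) atTop (𝓝 0)
  bound_L1 : ∃ M : ℝ, ∀ n, ∫ x in cube, ρ₀ n x ≤ M
  bound_Lγ : ∃ M : ℝ, ∀ n, ∫ x in cube, ρ₀ n x ^ γ ≤ M
  bound_grad_L2 : ∃ M : ℝ, ∀ n,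
    ∫ x in cube, normSq (grad (fun y => √(ρ₀ n y)) x) ≤ M
  bound_grad_L2τ : ∃ M : ℝ, ∀ n,
    ∫ x in cube, √(normSq (grad (fun y => √(ρ₀ n y)) x)) ^ (2 + τ) ≤ M
  tendsto_grad : ∃ G : Space → Space, MemLp G 2 (volume.restrict cube) ∧
    IsWeakGrad (fun y => √(ρlim y)) G ∧
    Tendsto (fun n => ∫ x in cube, normSq (grad (fun y => √(ρ₀ n y)) x - G x)) atTop (𝓝 0)

/-- The hypotheses on the sequence of initial velocities `u₀ n`, given the initial densities and
the limits `ρlim`, `ulim`. -/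
structure InitialVelocityHyp (τ : ℝ) (ρ₀ : ℕ → Space → ℝ) (u₀ : ℕ → Space → Space)
    (ρlim : Space → ℝ) (ulim : Space → Space) : Prop where
  smooth : ∀ n, ContDiff ℝ ∞ (u₀ n)
  periodic : ∀ n, Periodic (u₀ n)
  bound_L2 : ∃ M : ℝ, ∀ n, ∫ x in cube, normSq (√(ρ₀ n x) • u₀ n x) ≤ M
  bound_L2τ : ∃ M : ℝ, ∀ n, ∫ x in cube, √(normSq (√(ρ₀ n x) • u₀ n x)) ^ (2 + τ) ≤ M
  lim_integrable : IntegrableOn (fun x => ρlim x • ulim x) cube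
  tendsto_L1 : Tendsto
    (fun n => ∫ x in cube, √(normSq (ρ₀ n x • u₀ n x - ρlim x • ulim x))) atTop (𝓝 0)

/-- `(d/dt) ∫ ρ (1+|w|²/2) log(1+|w|²/2) dx`, added to the five dissipation integrals, equals the
three remaining integrals; here `Dw w ∇w w` is `∑ᵢⱼₖ (Dw)ᵢⱼ wᵢ (∂ⱼ wₖ) wₖ` and `w ∇w w` is
`∑ᵢₖ wᵢ (∂ᵢ wₖ) wₖ`. The functional is required to be differentiable at `t`. -/
def MVIdentityAt (μ lam γ : ℝ) (ρ : ℝ → Space → ℝ) (w : ℝ → Space → Space) (t : ℝ) : Prop :=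
  ∃ d : ℝ, HasDerivAt (fun s => mvEntropy (ρ s) (w s)) d t ∧
    d + μ * (∫ x in cube, ρ t x * ∑ i, ∑ j, jac (w t) x i j ^ 2)
      + μ * (∫ x in cube, ρ t x * (∑ i, ∑ j, jac (w t) x i j ^ 2) * logTerm (w t) x)
      + 2 * lam * (∫ x in cube, ρ t x * ∑ i, ∑ j, symGrad (w t) x i j ^ 2)
      + 2 * lam *
          (∫ x in cube, ρ t x * (∑ i, ∑ j, symGrad (w t) x i j ^ 2) * logTerm (w t) x)
      + μ * (∫ x in cube, ρ t x * normSq (grad (fun y => normSq (w t y) / 2) x)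
          * (2 / (2 + normSq (w t x))))
    = -(2 * lam * ∫ x in cube, ρ t x *
          (∑ i, ∑ j, ∑ k, symGrad (w t) x i j * w t x i * jac (w t) x k j * w t x k)
          * (2 / (2 + normSq (w t x))))
      + (∫ x in cube, ρ t x ^ γ * divergence (w t) x * (1 + logTerm (w t) x))
      + ∫ x in cube, ρ t x ^ γ *
          (∑ i, ∑ k, w t x i * jac (w t) x k i * w t x k) * (2 / (2 + normSq (w t x)))

end QNS

end

/-! Write ρ = exp L. With w = u + μ∇L, the relations μ + λ = ν and μ² + 2λμ = κ² absorb the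
third-order quantum term: L and w solve a transport-diffusion system whose right-hand sides are
`logDensityRate` and `velocityRate` (`IsSmoothSolution.timeDeriv_log_eq_rate`,
`IsSmoothSolution.hasDerivAt_effVel`).

For any admissible h, the time derivative of ρ h(|w|²/2) is then an explicit production density plus
the divergence of a periodic flux. This is a purely algebraic identity
(`entropy_balance_pointwise`), and the divergence integrates to zero. The choice h(y) = (1+y)
log(1+y) gives part (i). The choice h(y) = y, combined with the balance of ∫ρ^γ, gives an energy
law: with D = ∫ρ|∇w|² + ∫ρ^γ|∇L|², the energy decreases at rate at least μD.

For part (ii), the logarithmic dissipation absorbs the pressure terms by Young's inequality. What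
remains is at most a multiple of D plus a multiple of ∫ρ^(2γ-1)(1 + log(1+|w|²/2))
(`entropyProduction_log_le`). Sobolev's inequality for ρ^(γ/2), interpolated with the energy bound
on ∫ρ^γ, controls ∫ρ^(5γ/3) by 1 + D up to a constant (`exists_interpolation_const`). Since 2γ-1 <
5γ/3 exactly when γ < 3, there is room for the logarithm, which is paid for by ∫ρ(1+|w|²/2)
(`exists_rpow_mul_log_le`). So the entropy grows at rate at most K(1 + D), and the time integral of
D is bounded by the initial energy over μ. The initial energy is in turn bounded by the initial
entropy and the L^γ norm of the density. -/

namespace QNS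

/-- `f` is differentiable at `x` and `∂ⱼ f (x) = a`. -/
def HasPD (j : Fin 3) (f : Space → ℝ) (a : ℝ) (x : Space) : Prop :=
  DifferentiableAt ℝ f x ∧ pd j f x = a

/-! ### Calculus of partial derivatives -/

section PartialDerivatives

variable {j : Fin 3} {f g : Space → ℝ} {a b : ℝ} {x : Space}

lemma HasPD.congr_val (hf : HasPD j f a x) (h : a = b) : HasPD j f b x := h ▸ hf

lemma HasPD.add (hf : HasPD j f a x) (hg : HasPD j g b x) :
    HasPD j (fun y => f y + g y) (a + b) x := by
  refine ⟨hf.1.add hg.1, ?_⟩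
  rw [← hf.2, ← hg.2]
  simp [pd, fderiv_fun_add hf.1 hg.1]

lemma HasPD.sub (hf : HasPD j f a x) (hg : HasPD j g b x) :
    HasPD j (fun y => f y - g y) (a - b) x := by
  refine ⟨hf.1.sub hg.1, ?_⟩
  rw [← hf.2, ← hg.2]
  simp [pd, fderiv_fun_sub hf.1 hg.1]

lemma HasPD.neg (hf : HasPD j f a x) : HasPD j (fun y => - f y) (-a) x := by
  refine ⟨hf.1.neg, ?_⟩
  rw [← hf.2]
  simp [pd, fderiv_fun_neg]

lemma HasPD.mul (hf : HasPD j f a x) (hg : HasPD j g b x) :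
    HasPD j (fun y => f y * g y) (a * g x + f x * b) x := by
  refine ⟨hf.1.mul hg.1, ?_⟩
  rw [← hf.2, ← hg.2]
  simp [pd, fderiv_fun_mul hf.1 hg.1]
  ring

lemma HasPD.const_mul (c : ℝ) (hf : HasPD j f a x) : HasPD j (fun y => c * f y) (c * a) x := by
  refine ⟨hf.1.const_mul c, ?_⟩
  rw [← hf.2]
  simp [pd, fderiv_const_mul hf.1]

lemma HasPD.sum {f : Fin 3 → Space → ℝ} {a : Fin 3 → ℝ} (hf : ∀ i, HasPD j (f i) (a i) x) :
    HasPD j (fun y => ∑ i, f i y) (∑ i, a i) x := by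
  refine ⟨DifferentiableAt.fun_sum fun i _ => (hf i).1, ?_⟩
  simp only [← (hf _).2]
  simp [pd, fderiv_fun_sum fun i _ => (hf i).1]

lemma HasPD.comp {h : ℝ → ℝ} {h' : ℝ} (hh : HasDerivAt h h' (f x)) (hf : HasPD j f a x) :
    HasPD j (fun y => h (f y)) (h' * a) x := by
  have := hh.comp_hasFDerivAt x hf.1.hasFDerivAt
  refine ⟨this.differentiableAt, ?_⟩
  rw [← hf.2, pd]
  rw [show (fun y => h (f y)) = h ∘ f from rfl, this.fderiv]
  simp [pd]

lemma hasPD_of_contDiff (hf : ContDiff ℝ ∞ f) : HasPD j f (pd j f x) x :=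
  ⟨hf.differentiable (by simp) x, rfl⟩

lemma contDiff_pd (hf : ContDiff ℝ ∞ f) : ContDiff ℝ ∞ (pd j f) :=
  (hf.fderiv_right (m := ∞) (by simp)).clm_apply contDiff_const

lemma pd_comm (hf : ContDiff ℝ ∞ f) (i j : Fin 3) (x : Space) :
    pd i (pd j f) x = pd j (pd i f) x := by
  have hs : IsSymmSndFDerivAt ℝ f x := hf.contDiffAt.isSymmSndFDerivAt 
    (by simpa using WithTop.coe_le_coe.2 (le_top : (2 : ℕ∞) ≤ ⊤))
  have hd : DifferentiableAt ℝ (fderiv ℝ f) x :=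
    (hf.fderiv_right (m := ∞) (by simp)).differentiable (by simp) x
  have key : ∀ i j, pd i (pd j f) x
      = fderiv ℝ (fderiv ℝ f) x (Pi.single i 1) (Pi.single j 1) := by
    intro i j
    unfold pd
    rw [fderiv_clm_apply hd (by fun_prop)]
    simp
  rw [key, key, hs.eq]

lemma Periodic.pd (hf : Periodic f) (i : Fin 3) : Periodic (pd i f) := by
  intro x k
  have : f = fun y => f (y + Pi.single k 1) := funext fun y => (hf y k).symm
  unfold QNS.pd
  conv_rhs => rw [this]
  rw [fderiv_comp_add_right]

end PartialDerivatives

/-! ### Integration over the unit cube -/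

section Cube

lemma isCompact_cube : IsCompact cube := isCompact_Icc

lemma measurableSet_cube : MeasurableSet cube := measurableSet_Icc

lemma volume_cube : volume cube = 1 := by
  simp [cube, Real.volume_Icc_pi]

lemma volume_real_cube : volume.real cube = 1 := by simp [Measure.real, volume_cube]

lemma integrableOn_cube {f : Space → ℝ} (hf : Continuous f) : IntegrableOn f cube :=
  hf.continuousOn.integrableOn_compact isCompact_cube

/-- On the torus, the integral of a divergence vanishes. -/
lemma integral_divergence_eq_zero {F G : Fin 3 → Space → ℝ}
    (hF : ∀ j x, HasPD j (F j) (G j x) x) (hper : ∀ j, Periodic (F j))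
    (hG : Continuous fun x => ∑ j, G j x) : ∫ x in cube, ∑ j, G j x = 0 := by
  have h := integral_divergence_of_hasFDerivAt_off_countable' (0 : Space) 1
    (fun _ => zero_le_one) F (fun j x => fderiv ℝ (F j) x) ∅ Set.countable_empty
    (fun i x _ => (hF i x).1.continuousAt.continuousWithinAt)
    (fun x _ i => (hF i x).1.hasFDerivAt)
    (by
      have : (fun x => ∑ i, fderiv ℝ (F i) x (Pi.single i 1)) = fun x => ∑ j, G j x := by
        ext x
        exact Finset.sum_congr rfl fun j _ => (hF j x).2
      rw [this]
      exact integrableOn_cube hG)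
  have e : ∫ x in cube, ∑ j, G j x
      = ∫ x in Set.Icc (0 : Space) 1, ∑ i, fderiv ℝ (F i) x (Pi.single i 1) := by
    refine integral_congr_ae (Eventually.of_forall fun x => ?_)
    exact Finset.sum_congr rfl fun j _ => (hF j x).2.symm
  rw [e, h]
  -- The faces xᵢ = 1 and xᵢ = 0 differ by a unit translation, so periodicity makes their flux
  -- contributions cancel.
  refine Finset.sum_eq_zero fun i _ => ?_
  rw [sub_eq_zero]
  refine integral_congr_ae (Eventually.of_forall fun y => ?_)
  show F i (i.insertNth 1 y) = F i (i.insertNth 0 y)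
  rw [← hper i (i.insertNth 0 y) i]
  congr 1
  ext k
  refine Fin.succAboveCases i ?_ (fun k => ?_) k <;> simp

end Cube

end QNS

/-! ### Pointwise entropy balance for a general h -/

namespace QNS

/-- A smooth function `h` on `(-1, ∞)`, with `h1 = h'` and `h2 = h''`. -/
structure TwiceDiff (h h1 h2 : ℝ → ℝ) : Prop where
  deriv_zero : ∀ y, -1 < y → HasDerivAt h (h1 y) y
  deriv_one : ∀ y, -1 < y → HasDerivAt h1 (h2 y) y
  smooth : ContDiffOn ℝ ∞ h (Set.Ioi (-1))
  cont : ContinuousOn h2 (Set.Ioi (-1))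

/-- The right-hand side of the transport equation for `log ρ`, written for the effective
velocity `w`. -/
noncomputable def logDensityRate (m : ℝ) (L : Space → ℝ) (w : Space → Space) (x : Space) : ℝ :=
  -(∑ j, w x j * pd j L x) + m * (∑ j, pd j L x ^ 2) - (∑ j, jac w x j j)
    + m * ∑ j, pd j (pd j L) x

/-- The right-hand side of the equation for `∂ₜ wᵢ`, where `ρ = exp L`. -/
noncomputable def velocityRate (m l γ : ℝ) (L : Space → ℝ) (w : Space → Space) (x : Space)
    (i : Fin 3) : ℝ :=
  -(∑ j, w x j * jac w x i j)
    + 2 * l * (∑ j, ((pd j (pd j fun y => w y i) x + pd j (pd i fun y => w y j) x) / 2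
        + symGrad w x i j * pd j L x))
    + m * (∑ j, (2 * pd j L x * jac w x i j + pd j (pd j fun y => w y i) x))
    - γ * Real.exp ((γ - 1) * L x) * pd i L x

variable {L : Space → ℝ} {w : Space → Space}

lemma contDiff_coord (hw : ContDiff ℝ ∞ w) (i : Fin 3) : ContDiff ℝ ∞ fun y => w y i :=
  contDiff_pi.1 hw i

lemma contDiff_jac (hw : ContDiff ℝ ∞ w) (i j : Fin 3) : ContDiff ℝ ∞ fun y => jac w y i j :=
  contDiff_pd (contDiff_coord hw i)

lemma contDiff_symGrad (hw : ContDiff ℝ ∞ w) (i j : Fin 3) :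
    ContDiff ℝ ∞ fun y => symGrad w y i j :=
  ((contDiff_jac hw i j).add (contDiff_jac hw j i)).div_const 2

lemma normSq_nonneg (a : Space) : 0 ≤ normSq a := Finset.sum_nonneg fun i _ => sq_nonneg (a i)

lemma contDiff_normSq (hw : ContDiff ℝ ∞ w) : ContDiff ℝ ∞ fun y => normSq (w y) := by
  unfold normSq
  exact ContDiff.sum fun i _ => (contDiff_coord hw i).pow 2

lemma Periodic.coord (hw : Periodic w) (i : Fin 3) : Periodic fun y => w y i :=
  fun x k => by simp [hw x k]

lemma Periodic.jac (hw : Periodic w) (i j : Fin 3) : Periodic fun y => jac w y i j :=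
  (hw.coord i).pd j

lemma hasPD_kinetic (hw : ContDiff ℝ ∞ w) (j : Fin 3) (x : Space) :
    HasPD j (fun y => normSq (w y) / 2) (∑ k, w x k * jac w x k j) x := by
  have h1 : ∀ k, HasPD j (fun y => w y k ^ 2) (2 * (w x k * jac w x k j)) x := fun k => by
    have := (hasPD_of_contDiff (j := j) (x := x) (contDiff_coord hw k))
    simp only [pow_two]
    exact (this.mul this).congr_val (by simp only [jac]; ring)
  have h2 := (HasPD.sum h1).const_mul (1 / 2)
  have e : (fun y => normSq (w y) / 2) = fun y => 1 / 2 * ∑ k, w y k ^ 2 := by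
    ext y; simp only [normSq]; ring
  rw [e]
  refine h2.congr_val ?_
  rw [← Finset.mul_sum]; ring

lemma continuous_comp_kinetic {h : ℝ → ℝ} (hh : ContinuousOn h (Set.Ioi (-1)))
    (hw : ContDiff ℝ ∞ w) : Continuous fun x => h (normSq (w x) / 2) :=
  hh.comp_continuous ((contDiff_normSq hw).continuous.div_const 2) fun x =>
    show (-1 : ℝ) < normSq (w x) / 2 by linarith [normSq_nonneg (w x)]

lemma TwiceDiff.continuousOn {h h1 h2 : ℝ → ℝ} (hh : TwiceDiff h h1 h2) :
    ContinuousOn h (Set.Ioi (-1)) :=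
  fun y hy => (hh.deriv_zero y hy).continuousAt.continuousWithinAt

lemma TwiceDiff.continuousOn_one {h h1 h2 : ℝ → ℝ} (hh : TwiceDiff h h1 h2) :
    ContinuousOn h1 (Set.Ioi (-1)) :=
  fun y hy => (hh.deriv_one y hy).continuousAt.continuousWithinAt

/-- The flux whose divergence balances the entropy `ρ h(|w|²/2)`, `ρ = exp L`. -/
noncomputable def entropyFlux (m l γ : ℝ) (h h1 : ℝ → ℝ) (L : Space → ℝ) (w : Space → Space)
    (j : Fin 3) (x : Space) : ℝ :=
  Real.exp (L x) * (h (normSq (w x) / 2) * (m * pd j L x - w x j))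
    + Real.exp (L x) * (h1 (normSq (w x) / 2) *
      (m * (∑ k, w x k * jac w x k j) + 2 * l * ∑ i, w x i * symGrad w x i j))
    - Real.exp (γ * L x) * (h1 (normSq (w x) / 2) * w x j)

/-- The partial derivative `∂ⱼ` of the `j`-th component of `entropyFlux`. -/
noncomputable def entropyFluxDeriv (m l γ : ℝ) (h h1 h2 : ℝ → ℝ) (L : Space → ℝ)
    (w : Space → Space) (j : Fin 3) (x : Space) : ℝ :=
  let φ := normSq (w x) / 2
  let φj := ∑ k, w x k * jac w x k j
  let F := m * φj + 2 * l * ∑ i, w x i * symGrad w x i j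
  let Fj := m * (∑ k, (jac w x k j * jac w x k j + w x k * pd j (pd j fun y => w y k) x))
    + 2 * l * ∑ i, (jac w x i j * symGrad w x i j
      + w x i * ((pd j (pd j fun y => w y i) x + pd j (pd i fun y => w y j) x) / 2))
  Real.exp (L x) * (pd j L x * (h φ * (m * pd j L x - w x j))
      + h1 φ * φj * (m * pd j L x - w x j) + h φ * (m * pd j (pd j L) x - jac w x j j))
    + Real.exp (L x) * (pd j L x * (h1 φ * F) + h2 φ * φj * F + h1 φ * Fj)
    - Real.exp (γ * L x) * (γ * pd j L x * (h1 φ * w x j) + h2 φ * φj * w x j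
      + h1 φ * jac w x j j)

lemma hasPD_entropyFlux (m l γ : ℝ) {h h1 h2 : ℝ → ℝ} (hh : TwiceDiff h h1 h2)
    (hL : ContDiff ℝ ∞ L) (hw : ContDiff ℝ ∞ w) (j : Fin 3) (x : Space) :
    HasPD j (entropyFlux m l γ h h1 L w j) (entropyFluxDeriv m l γ h h1 h2 L w j x) x := by
  have hφ0 : (-1 : ℝ) < normSq (w x) / 2 := by linarith [normSq_nonneg (w x)]
  have dL : HasPD j L (pd j L x) x := hasPD_of_contDiff hL
  have dLj : HasPD j (pd j L) (pd j (pd j L) x) x := hasPD_of_contDiff (contDiff_pd hL)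
  have dw : ∀ k, HasPD j (fun y => w y k) (jac w x k j) x := fun k =>
    hasPD_of_contDiff (contDiff_coord hw k)
  have dJ : ∀ k i, HasPD j (fun y => jac w y k i) (pd j (pd i fun y => w y k) x) x := fun k i =>
    hasPD_of_contDiff (contDiff_jac hw k i)
  have dS : ∀ i, HasPD j (fun y => symGrad w y i j)
      ((pd j (pd j fun y => w y i) x + pd j (pd i fun y => w y j) x) / 2) x := fun i => by
    have := ((dJ i j).add (dJ j i)).const_mul (1 / 2)
    have e : (fun y => symGrad w y i j) = fun y => 1 / 2 * (jac w y i j + jac w y j i) := by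
      ext y; simp only [symGrad]; ring
    rw [e]
    exact this.congr_val (by ring)
  have dφ := hasPD_kinetic hw j x
  have dh := HasPD.comp (hh.deriv_zero _ hφ0) dφ
  have dh1 := HasPD.comp (hh.deriv_one _ hφ0) dφ
  have dE := HasPD.comp (Real.hasDerivAt_exp (L x)) dL
  have dEγ := HasPD.comp (Real.hasDerivAt_exp (γ * L x)) (dL.const_mul γ)
  have dF1 := (HasPD.sum fun k => (dw k).mul (dJ k j)).const_mul m
  have dF2 := (HasPD.sum fun i => (dw i).mul (dS i)).const_mul (2 * l)
  have d1 := dE.mul (dh.mul ((dLj.const_mul m).sub (dw j)))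
  have d2 := dE.mul (dh1.mul (dF1.add dF2))
  have d3 := dEγ.mul (dh1.mul (dw j))
  refine ((d1.add d2).sub d3).congr_val ?_
  simp only [entropyFluxDeriv]
  ring

lemma entropyFlux_periodic (m l γ : ℝ) (h h1 : ℝ → ℝ)
    (pL : Periodic L) (pw : Periodic w) (j : Fin 3) :
    Periodic (entropyFlux m l γ h h1 L w j) := by
  intro x k
  have hj : ∀ a b, jac w (x + Pi.single k 1) a b = jac w x a b := fun a b => pw.jac a b x k
  have hp : pd j L (x + Pi.single k 1) = pd j L x := pL.pd j x k
  simp only [entropyFlux, pL x k, pw x k, hj, hp, symGrad]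

lemma exp_mul_exp_sub_one (γ s : ℝ) :
    Real.exp (γ * s) = Real.exp s * Real.exp ((γ - 1) * s) := by
  rw [← Real.exp_add]; congr 1; ring

/-- Dissipation and production density in the entropy balance. -/
noncomputable def entropyProduction (m l γ : ℝ) (h1 h2 : ℝ → ℝ) (L : Space → ℝ)
    (w : Space → Space) (x : Space) : ℝ :=
  let φ := normSq (w x) / 2;
  -(m * (Real.exp (L x) * (∑ i, ∑ j, jac w x i j ^ 2) * h1 φ))
    - m * (Real.exp (L x) * (∑ j, (∑ k, w x k * jac w x k j) ^ 2) * h2 φ)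
    - 2 * l * (Real.exp (L x) * (∑ i, ∑ j, symGrad w x i j ^ 2) * h1 φ)
    - 2 * l * (Real.exp (L x) *
        (∑ i, ∑ j, ∑ k, symGrad w x i j * w x i * jac w x k j * w x k) * h2 φ)
    + Real.exp (γ * L x) * divergence w x * h1 φ
    + Real.exp (γ * L x) * (∑ i, ∑ k, w x i * jac w x k i * w x k) * h2 φ

/-- The left side is what the chain rule gives for ∂ₜ(ρ h(|w|²/2)) once both rates are substituted.
No relation between `h`, `h1` and `h2` is needed at this level, nor symmetry of second derivatives:
the second-order terms occur in the same order on both sides. Factoring exp(γL) makes the pressure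
gradient match the flux term ρ^γ h' w. -/
lemma entropy_balance_pointwise (m l γ : ℝ) (h h1 h2 : ℝ → ℝ) (L : Space → ℝ)
    (w : Space → Space) (x : Space) :
    Real.exp (L x) * (logDensityRate m L w x * h (normSq (w x) / 2)
        + h1 (normSq (w x) / 2) * ∑ i, w x i * velocityRate m l γ L w x i)
      = entropyProduction m l γ h1 h2 L w x + ∑ j, entropyFluxDeriv m l γ h h1 h2 L w j x := by
  have hP := exp_mul_exp_sub_one γ (L x)
  simp only [logDensityRate, velocityRate, entropyProduction, entropyFluxDeriv, divergence,
    symGrad, jac, Fin.sum_univ_three, hP]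
  ring

end QNS

/-! ### Integrated balances at a fixed time -/

namespace QNS

variable {L : Space → ℝ} {w : Space → Space}

@[fun_prop]
lemma continuous_pd {f : Space → ℝ} (hf : ContDiff ℝ ∞ f) (j : Fin 3) : Continuous (pd j f) :=
  (contDiff_pd hf).continuous

@[fun_prop]
lemma continuous_pd_pd {f : Space → ℝ} (hf : ContDiff ℝ ∞ f) (i j : Fin 3) :
    Continuous (pd i (pd j f)) :=
  (contDiff_pd (contDiff_pd hf)).continuous

@[fun_prop]
lemma continuous_jac (hw : ContDiff ℝ ∞ w) (i j : Fin 3) : Continuous fun x => jac w x i j :=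
  (contDiff_jac hw i j).continuous

@[fun_prop]
lemma continuous_symGrad (hw : ContDiff ℝ ∞ w) (i j : Fin 3) :
    Continuous fun x => symGrad w x i j :=
  (contDiff_symGrad hw i j).continuous

@[fun_prop]
lemma continuous_normSq (hw : ContDiff ℝ ∞ w) : Continuous fun x => normSq (w x) :=
  (contDiff_normSq hw).continuous

@[fun_prop]
lemma continuous_divergence (hw : ContDiff ℝ ∞ w) : Continuous fun x => divergence w x :=
  continuous_finsetSum _ fun i _ => continuous_jac hw i i

@[fun_prop]
lemma continuous_pd_coord (hw : ContDiff ℝ ∞ w) (i k : Fin 3) :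
    Continuous fun x => pd i (fun y => w y k) x := continuous_jac hw k i

@[fun_prop]
lemma continuous_pd_pd_coord (hw : ContDiff ℝ ∞ w) (i j k : Fin 3) :
    Continuous fun x => pd i (pd j fun y => w y k) x := continuous_pd_pd (contDiff_coord hw k) i j

/-- Truncating the argument at 0 makes the function continuous on all of ℝ without changing its
values at |w|²/2 ≥ 0. Continuity of composite expressions can then be derived with no side condition
on the domain. -/
lemma continuous_comp_max {h : ℝ → ℝ} (hh : ContinuousOn h (Set.Ioi (-1))) :
    Continuous fun y => h (max y 0) :=
  hh.comp_continuous (by fun_prop) fun y =>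
    show (-1 : ℝ) < max y 0 from lt_of_lt_of_le (by norm_num) (le_max_right y 0)

lemma max_kinetic (a : Space) : max (normSq a / 2) 0 = normSq a / 2 :=
  max_eq_left (div_nonneg (normSq_nonneg a) zero_le_two)

lemma continuous_entropyFluxDeriv (m l γ : ℝ) {h h1 h2 : ℝ → ℝ} (hh : TwiceDiff h h1 h2)
    (hL : ContDiff ℝ ∞ L) (hw : ContDiff ℝ ∞ w) (j : Fin 3) :
    Continuous (entropyFluxDeriv m l γ h h1 h2 L w j) := by
  have key : ∀ {a b c : ℝ → ℝ}, Continuous a → Continuous b → Continuous c →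
      Continuous (entropyFluxDeriv m l γ a b c L w j) := by
    intro a b c ha hb hc
    have cw := hw.continuous
    have cL := hL.continuous
    unfold entropyFluxDeriv
    fun_prop
  have e : entropyFluxDeriv m l γ h h1 h2 L w j = entropyFluxDeriv m l γ (fun y => h (max y 0))
      (fun y => h1 (max y 0)) (fun y => h2 (max y 0)) L w j := by
    ext x
    simp only [entropyFluxDeriv, max_kinetic]
  rw [e]
  exact key (continuous_comp_max hh.continuousOn) (continuous_comp_max hh.continuousOn_one)
    (continuous_comp_max hh.cont)

lemma continuous_entropyProduction (m l γ : ℝ) {h h1 h2 : ℝ → ℝ} (hh : TwiceDiff h h1 h2)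
    (hL : ContDiff ℝ ∞ L) (hw : ContDiff ℝ ∞ w) :
    Continuous (entropyProduction m l γ h1 h2 L w) := by
  have key : ∀ {b c : ℝ → ℝ}, Continuous b → Continuous c →
      Continuous (entropyProduction m l γ b c L w) := by
    intro b c hb hc
    have cw := hw.continuous
    have cL := hL.continuous
    unfold entropyProduction
    fun_prop
  have e : entropyProduction m l γ h1 h2 L w = entropyProduction m l γ
      (fun y => h1 (max y 0)) (fun y => h2 (max y 0)) L w := by
    ext x
    simp only [entropyProduction, max_kinetic]
  rw [e]
  exact key (continuous_comp_max hh.continuousOn_one) (continuous_comp_max hh.cont)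

/-- Integrated entropy balance at a fixed time. -/
lemma integral_entropy_balance (m l γ : ℝ) {h h1 h2 : ℝ → ℝ} (hh : TwiceDiff h h1 h2)
    (hL : ContDiff ℝ ∞ L) (hw : ContDiff ℝ ∞ w) (pL : Periodic L) (pw : Periodic w) :
    ∫ x in cube, Real.exp (L x) * (logDensityRate m L w x * h (normSq (w x) / 2)
        + h1 (normSq (w x) / 2) * ∑ i, w x i * velocityRate m l γ L w x i)
      = ∫ x in cube, entropyProduction m l γ h1 h2 L w x := by
  have hc : Continuous fun x => ∑ j, entropyFluxDeriv m l γ h h1 h2 L w j x :=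
    continuous_finsetSum _ fun j _ => continuous_entropyFluxDeriv m l γ hh hL hw j
  rw [integral_congr_ae (Eventually.of_forall fun x =>
    entropy_balance_pointwise m l γ h h1 h2 L w x),
    integral_add (integrableOn_cube (continuous_entropyProduction m l γ hh hL hw))
    (integrableOn_cube hc),
    integral_divergence_eq_zero (fun j x => hasPD_entropyFlux m l γ hh hL hw j x)
      (fun j => entropyFlux_periodic m l γ h h1 pL pw j) hc, add_zero]

/-- Balance of the pressure potential at a fixed time. -/
lemma integral_pressure_balance (m γ : ℝ)
    (hL : ContDiff ℝ ∞ L) (hw : ContDiff ℝ ∞ w) (pL : Periodic L) (pw : Periodic w) :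
    ∫ x in cube, γ * Real.exp (γ * L x) * logDensityRate m L w x
      = ∫ x in cube, (γ - 1) * (-(Real.exp (γ * L x) * divergence w x)
          - m * γ * (Real.exp (γ * L x) * ∑ j, pd j L x ^ 2)) := by
  have dE : ∀ j x, HasPD j (fun y => Real.exp (γ * L y))
      (Real.exp (γ * L x) * (γ * pd j L x)) x := fun j x =>
    HasPD.comp (Real.hasDerivAt_exp (γ * L x)) ((hasPD_of_contDiff hL).const_mul γ)
  -- The flux is ρ^γ(γ m ∂ⱼL - wⱼ). Its divergence removes the Laplacian of L and the transport
  -- term, and leaves the factor γ - 1 on the remainder.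
  have dF := fun j x => (dE j x).mul
    (((hasPD_of_contDiff (j := j) (x := x) (contDiff_pd (j := j) hL)).const_mul (γ * m)).sub
      (hasPD_of_contDiff (contDiff_coord hw j)))
  have hper : ∀ j, Periodic fun y =>
      Real.exp (γ * L y) * (γ * m * pd j L y - w y j) := fun j x k => by
    simp only [pL x k, pw x k, pL.pd j x k]
  have cL := hL.continuous
  have cw := hw.continuous
  have hc : Continuous fun x => ∑ j, (Real.exp (γ * L x) * (γ * pd j L x)
      * (γ * m * pd j L x - w x j)
      + Real.exp (γ * L x) * (γ * m * pd j (pd j L) x - pd j (fun y => w y j) x)) := by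
    fun_prop
  have h0 := integral_divergence_eq_zero dF hper hc
  have hc2 : Continuous fun x => (γ - 1) * (-(Real.exp (γ * L x) * divergence w x)
          - m * γ * (Real.exp (γ * L x) * ∑ j, pd j L x ^ 2)) := by fun_prop
  rw [← add_zero (∫ x in cube, (γ - 1) * _), ← h0,
    ← integral_add (integrableOn_cube hc2) (integrableOn_cube hc)]
  refine integral_congr_ae (Eventually.of_forall fun x => ?_)
  simp only [logDensityRate, divergence, jac, Fin.sum_univ_three]
  ring

end QNS

/-! ### Time derivatives and parameter integrals on the space-time slab -/

namespace QNS

/-- Joint smoothness on the space-time slab `[0, T) × ℝ³`. -/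
def SlabSmooth (T : ℝ) (F : ℝ → Space → ℝ) : Prop :=
  ContDiffOn ℝ ∞ (fun p : ℝ × Space => F p.1 p.2) (Set.Ico 0 T ×ˢ Set.univ)

/-- The time derivative, one-sided at the initial time. -/
noncomputable def timeDeriv (T : ℝ) (F : ℝ → Space → ℝ) (t : ℝ) (x : Space) : ℝ :=
  fderivWithin ℝ (fun p : ℝ × Space => F p.1 p.2) (Set.Ico 0 T ×ˢ Set.univ) (t, x) (1, 0)

section Slab

variable {T t : ℝ} {F : ℝ → Space → ℝ}

lemma uniqueDiffOn_slab (T : ℝ) :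
    UniqueDiffOn ℝ (Set.Ico 0 T ×ˢ Set.univ : Set (ℝ × Space)) :=
  (uniqueDiffOn_Ico 0 T).prod uniqueDiffOn_univ

lemma slab_mem_nhds (ht : t ∈ Set.Ioo 0 T) (x : Space) :
    (Set.Ico 0 T ×ˢ Set.univ : Set (ℝ × Space)) ∈ 𝓝 (t, x) :=
  prod_mem_nhds (Ico_mem_nhds ht.1 ht.2) univ_mem

lemma SlabSmooth.slice (hF : SlabSmooth T F) (ht : t ∈ Set.Ico 0 T) : ContDiff ℝ ∞ (F t) := by
  rw [← contDiffOn_univ]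
  exact hF.comp (f := fun x : Space => (t, x)) (by fun_prop) fun x _ => ⟨ht, Set.mem_univ _⟩

lemma SlabSmooth.differentiableWithinAt (hF : SlabSmooth T F) (ht : t ∈ Set.Ico 0 T) (x : Space) :
    DifferentiableWithinAt ℝ (fun p : ℝ × Space => F p.1 p.2) (Set.Ico 0 T ×ˢ Set.univ) (t, x) :=
  hF.differentiableOn (by simp) (t, x) ⟨ht, Set.mem_univ _⟩

/-- Space directions are unrestricted in the slab, so this holds at t = 0 as well; it is what makes
spatial derivatives jointly smooth up to the initial time. -/
lemma SlabSmooth.pd_eq (hF : SlabSmooth T F) (ht : t ∈ Set.Ico 0 T) (i : Fin 3) (x : Space) :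
    pd i (F t) x = fderivWithin ℝ (fun p : ℝ × Space => F p.1 p.2) (Set.Ico 0 T ×ˢ Set.univ)
      (t, x) (0, Pi.single i 1) := by
  have h1 := (hF.differentiableWithinAt ht x).hasFDerivWithinAt
  have h2 : HasFDerivWithinAt (fun y : Space => (t, y)) (ContinuousLinearMap.inr ℝ ℝ Space)
      Set.univ x := (hasFDerivAt_prodMk_right t x).hasFDerivWithinAt
  have h3 := h1.comp x h2 fun y _ => ⟨ht, Set.mem_univ _⟩
  rw [hasFDerivWithinAt_univ] at h3
  have h4 : fderiv ℝ (F t) x = _ := h3.fderiv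
  rw [pd, h4]
  simp

lemma SlabSmooth.apply_fderivWithin (hF : SlabSmooth T F) (v : ℝ × Space) :
    ContDiffOn ℝ ∞ (fun p : ℝ × Space =>
      fderivWithin ℝ (fun p : ℝ × Space => F p.1 p.2) (Set.Ico 0 T ×ˢ Set.univ) p v)
      (Set.Ico 0 T ×ˢ Set.univ) :=
  (hF.fderivWithin (uniqueDiffOn_slab T) (m := ∞) (by simp)).clm_apply contDiffOn_const

lemma SlabSmooth.pd (hF : SlabSmooth T F) (i : Fin 3) : SlabSmooth T fun s => pd i (F s) :=
  (hF.apply_fderivWithin (0, Pi.single i 1)).congr fun p hp => hF.pd_eq hp.1 i p.2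

lemma SlabSmooth.timeDeriv (hF : SlabSmooth T F) : SlabSmooth T (timeDeriv T F) :=
  hF.apply_fderivWithin (1, 0)

lemma SlabSmooth.hasDerivAt (hF : SlabSmooth T F) (ht : t ∈ Set.Ioo 0 T) (x : Space) :
    HasDerivAt (fun s => F s x) (QNS.timeDeriv T F t x) t := by
  have h1 := (hF.differentiableWithinAt ⟨ht.1.le, ht.2⟩ x).hasFDerivWithinAt.hasFDerivAt
    (slab_mem_nhds ht x)
  have h2 : HasDerivAt (fun s : ℝ => (s, x)) ((1 : ℝ), (0 : Space)) t :=
    (hasDerivAt_id t).prodMk (hasDerivAt_const t x)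
  exact h1.comp_hasDerivAt (f := fun s : ℝ => (s, x)) t h2

/-- Schwarz's theorem for one time and one space derivative. Near an interior time the derivative
within the slab is the full derivative, so symmetry of the second derivative applies. -/
lemma SlabSmooth.hasDerivAt_pd (hF : SlabSmooth T F) (ht : t ∈ Set.Ioo 0 T) (i : Fin 3)
    (x : Space) :
    HasDerivAt (fun s => QNS.pd i (F s) x) (QNS.pd i (QNS.timeDeriv T F t) x) t := by
  have ht' : t ∈ Set.Ico 0 T := ⟨ht.1.le, ht.2⟩
  refine ((hF.pd i).hasDerivAt ht x).congr_deriv ?_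
  rw [hF.timeDeriv.pd_eq ht']
  set S : Set (ℝ × Space) := Set.Ico 0 T ×ˢ Set.univ with hS
  set f : ℝ × Space → ℝ := fun p => F p.1 p.2 with hf
  have hmem : S ∈ 𝓝 (t, x) := slab_mem_nhds ht x
  have hfc : ContDiffAt ℝ ∞ f (t, x) := hF.contDiffAt hmem
  have hs : IsSymmSndFDerivAt ℝ f (t, x) := hfc.isSymmSndFDerivAt
    (by simpa using WithTop.coe_le_coe.2 (le_top : (2 : ℕ∞) ≤ ⊤))
  have hd : DifferentiableAt ℝ (fderiv ℝ f) (t, x) :=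
    (hfc.fderiv_right (m := ∞) (by simp)).differentiableAt (by simp)
  have hint : ∀ᶠ p in 𝓝 (t, x), S ∈ 𝓝 p := eventually_mem_nhds_iff.2 hmem
  have key : ∀ (v v' : ℝ × Space) (g : ℝ × Space → ℝ), (∀ p ∈ S, g p = fderivWithin ℝ f S p v) →
      fderivWithin ℝ g S (t, x) v' = fderiv ℝ (fderiv ℝ f) (t, x) v' v := by
    intro v v' g hg
    have hev : g =ᶠ[𝓝 (t, x)] fun p => fderiv ℝ f p v := by
      filter_upwards [hint] with p hp
      rw [hg p (mem_of_mem_nhds hp), fderivWithin_of_mem_nhds hp]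
    rw [fderivWithin_of_mem_nhds hmem, hev.fderiv_eq, fderiv_clm_apply hd (by fun_prop)]
    simp
  rw [QNS.timeDeriv, key (0, Pi.single i 1) (1, 0) _ fun p hp => hF.pd_eq hp.1 i p.2,
    key (1, 0) (0, Pi.single i 1) (fun p => QNS.timeDeriv T F p.1 p.2) fun p _ => rfl, hs.eq]

/-- Dominated convergence with a constant bound. The time t = 0 is included, so that monotonicity
obtained on (0, T) extends to the initial data. -/
lemma continuousOn_slab_integral
    (hF : ContinuousOn (fun p : ℝ × Space => F p.1 p.2) (Set.Ico 0 T ×ˢ Set.univ)) :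
    ContinuousOn (fun s => ∫ x in cube, F s x) (Set.Ico 0 T) := by
  intro t ht
  -- Stopping strictly before T gives a compact set [0, a] × cube on which `F` is bounded.
  set a := (t + T) / 2 with ha
  have hta : t < a := by rw [ha]; linarith [ht.2]
  have haT : a < T := by rw [ha]; linarith [ht.2]
  have hsub : (Set.Icc 0 a ×ˢ cube : Set (ℝ × Space)) ⊆ Set.Ico 0 T ×ˢ Set.univ :=
    Set.prod_mono (fun s hs => ⟨hs.1, hs.2.trans_lt haT⟩) (Set.subset_univ _)
  obtain ⟨M, hM⟩ := ((isCompact_Icc.prod isCompact_cube).bddAbove_image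
    (hF.mono hsub).norm)
  have hslice : ∀ s ∈ Set.Ico 0 T, Continuous (F s) := fun s hs =>
    hF.comp_continuous (Continuous.prodMk_right s) fun x => Set.mk_mem_prod hs (Set.mem_univ x)
  refine continuousWithinAt_of_dominated (bound := fun _ => M) ?_ ?_ ?_ ?_
  · filter_upwards [self_mem_nhdsWithin] with s hs
    exact (hslice s hs).aestronglyMeasurable
  · filter_upwards [self_mem_nhdsWithin, nhdsWithin_le_nhds (Iio_mem_nhds hta)] with s hs hs'
    rw [ae_restrict_iff' measurableSet_cube]
    refine Eventually.of_forall fun x hx => ?_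
    have hp : (s, x) ∈ Set.Icc 0 a ×ˢ cube := ⟨⟨hs.1, le_of_lt hs'⟩, hx⟩
    exact hM (Set.mem_image_of_mem _ hp)
  · exact integrableOn_const (by simp [volume_cube])
  · refine Eventually.of_forall fun x => ?_
    have hc : ContinuousWithinAt (fun s : ℝ => (s, x)) (Set.Ico 0 T) t := by fun_prop
    have hmaps : Set.MapsTo (fun s : ℝ => (s, x)) (Set.Ico 0 T) (Set.Ico 0 T ×ˢ Set.univ) :=
      fun s hs => ⟨hs, Set.mem_univ _⟩
    exact ContinuousWithinAt.comp (g := fun p : ℝ × Space => F p.1 p.2)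
      (f := fun s : ℝ => (s, x)) (x := t) (hF (t, x) ⟨ht, Set.mem_univ _⟩) hc hmaps

/-- Differentiation under the integral sign over the torus. -/
lemma SlabSmooth.hasDerivAt_integral (hF : SlabSmooth T F) (ht : t ∈ Set.Ioo 0 T) :
    HasDerivAt (fun s => ∫ x in cube, F s x) (∫ x in cube, QNS.timeDeriv T F t x) t := by
  obtain ⟨a, ha0, hat⟩ := exists_between ht.1
  obtain ⟨b, htb, hbT⟩ := exists_between ht.2
  have hsub : (Set.Icc a b ×ˢ cube : Set (ℝ × Space)) ⊆ Set.Ico 0 T ×ˢ Set.univ :=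
    Set.prod_mono (fun s hs => ⟨ha0.le.trans hs.1, hs.2.trans_lt hbT⟩) (Set.subset_univ _)
  obtain ⟨M, hM⟩ := ((isCompact_Icc.prod isCompact_cube).bddAbove_image
    (hF.timeDeriv.continuousOn.mono hsub).norm)
  have ht' : t ∈ Set.Ico 0 T := ⟨ht.1.le, ht.2⟩
  refine (hasDerivAt_integral_of_dominated_loc_of_deriv_le (Icc_mem_nhds hat htb)
    (bound := fun _ => M) (F' := QNS.timeDeriv T F) ?_ ?_ ?_ ?_ ?_ ?_).2
  · filter_upwards [Ico_mem_nhds ht.1 ht.2] with s hs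
    exact (hF.slice hs).continuous.aestronglyMeasurable
  · exact integrableOn_cube (hF.slice ht').continuous
  · exact (hF.timeDeriv.slice ht').continuous.aestronglyMeasurable
  · rw [ae_restrict_iff' measurableSet_cube]
    exact Eventually.of_forall fun x hx s hs => hM (Set.mem_image_of_mem _ (Set.mk_mem_prod hs hx))
  · exact integrableOn_const (by simp [volume_cube])
  · exact Eventually.of_forall fun x s hs =>
      hF.hasDerivAt ⟨ha0.trans_le hs.1, hs.2.trans_lt hbT⟩ x

end Slab

end QNS

/-! ### The system in terms of log ρ and u -/

namespace QNS

/-- The logarithm of the density. -/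
noncomputable def logDensity (ρ : ℝ → Space → ℝ) (t : ℝ) (x : Space) : ℝ := Real.log (ρ t x)

lemma mu_add_lam (ν κ : ℝ) : mu ν κ + lam ν κ = ν := by simp [mu, lam]

/-- Together with `mu_add_lam`, this is the algebra behind the effective velocity: one relation
matches the viscous terms, the other the quantum terms. -/
lemma mu_sq_add {ν κ : ℝ} (hκ : 0 < κ) (hκν : κ < ν) :
    mu ν κ ^ 2 + 2 * lam ν κ * mu ν κ = κ ^ 2 := by
  have h : √(ν ^ 2 - κ ^ 2) ^ 2 = ν ^ 2 - κ ^ 2 := Real.sq_sqrt (by nlinarith)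
  simp only [mu, lam]
  linear_combination (-1) * h

lemma mu_pos {ν κ : ℝ} (hκ : 0 < κ) (hκν : κ < ν) : 0 < mu ν κ := by
  have : √(ν ^ 2 - κ ^ 2) < ν := by
    rw [Real.sqrt_lt' (hκ.trans hκν)]
    nlinarith
  simp only [mu]; linarith

lemma lam_nonneg (ν κ : ℝ) : 0 ≤ lam ν κ := Real.sqrt_nonneg _

section Bohm

variable {L : Space → ℝ} (hL : ContDiff ℝ ∞ L)
include hL

/-- Since √ρ = exp(L/2), each second derivative of √ρ carries the factor √ρ, and the quotient is
polynomial in the derivatives of L. -/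
lemma laplacian_sqrt_exp_div (x : Space) :
    laplacian (fun z => √(Real.exp (L z))) x / √(Real.exp (L x))
      = ∑ j, (1 / 2 * pd j (pd j L) x + 1 / 4 * (pd j L x * pd j L x)) := by
  have e : (fun z => √(Real.exp (L z))) = fun z => Real.exp (1 / 2 * L z) := by
    ext z; rw [← Real.exp_half]; congr 1; ring
  have d : ∀ j x, HasPD j (fun z => Real.exp (1 / 2 * L z))
      (Real.exp (1 / 2 * L x) * (1 / 2 * pd j L x)) x := fun j x =>
    HasPD.comp (Real.hasDerivAt_exp (1 / 2 * L x)) ((hasPD_of_contDiff hL).const_mul _)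
  have d1 : ∀ j, pd j (fun z => Real.exp (1 / 2 * L z))
      = fun x => Real.exp (1 / 2 * L x) * (1 / 2 * pd j L x) := fun j => funext fun x => (d j x).2
  have d2 : ∀ j, pd j (pd j fun z => Real.exp (1 / 2 * L z)) x
      = Real.exp (1 / 2 * L x) * (1 / 2 * pd j (pd j L) x + 1 / 4 * (pd j L x * pd j L x)) := by
    intro j
    rw [d1 j]
    refine ((d j x).mul ((hasPD_of_contDiff (contDiff_pd hL)).const_mul (1 / 2))).2.trans ?_
    ring
  rw [show √(Real.exp (L x)) = Real.exp (1 / 2 * L x) from congrFun e x, e, laplacian]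
  simp only [d2]
  rw [← Finset.mul_sum, mul_div_cancel_left₀ _ (Real.exp_ne_zero _)]

lemma pd_bohm (i : Fin 3) (x : Space) :
    pd i (fun y => laplacian (fun z => √(Real.exp (L z))) y / √(Real.exp (L y))) x
      = ∑ j, (1 / 2 * pd i (pd j (pd j L)) x + 1 / 2 * (pd j L x * pd i (pd j L) x)) := by
  simp only [laplacian_sqrt_exp_div hL]
  have d1 : ∀ j, HasPD i (pd j L) (pd i (pd j L) x) x := fun j =>
    hasPD_of_contDiff (contDiff_pd hL)
  have d2 : ∀ j, HasPD i (pd j (pd j L)) (pd i (pd j (pd j L)) x) x := fun j =>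
    hasPD_of_contDiff (contDiff_pd (contDiff_pd hL))
  have := HasPD.sum fun j => ((d2 j).const_mul (1 / 2)).add (((d1 j).mul (d1 j)).const_mul (1 / 4))
  rw [this.2]
  exact Finset.sum_congr rfl fun j _ => by ring

end Bohm

section Solution

variable {ν κ γ T t : ℝ} {ρ : ℝ → Space → ℝ} {u : ℝ → Space → Space}

lemma IsSmoothSolution.smooth_log (h : IsSmoothSolution ν κ γ T ρ u) :
    SlabSmooth T (logDensity ρ) :=
  ContDiffOn.log h.smooth_density fun p hp => (h.density_pos p.1 hp.1 p.2).ne'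

lemma IsSmoothSolution.density_eq (h : IsSmoothSolution ν κ γ T ρ u) (ht : t ∈ Set.Ico 0 T)
    (x : Space) : ρ t x = Real.exp (logDensity ρ t x) :=
  (Real.exp_log (h.density_pos t ht x)).symm

lemma IsSmoothSolution.smooth_coord (h : IsSmoothSolution ν κ γ T ρ u) (i : Fin 3) :
    SlabSmooth T fun s x => u s x i :=
  contDiffOn_pi.1 h.smooth_velocity i

lemma IsSmoothSolution.slice_velocity (h : IsSmoothSolution ν κ γ T ρ u)
    (ht : t ∈ Set.Ico 0 T) : ContDiff ℝ ∞ (u t) :=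
  contDiff_pi.2 fun i => (h.smooth_coord i).slice ht

lemma IsSmoothSolution.periodic_log (h : IsSmoothSolution ν κ γ T ρ u) (ht : t ∈ Set.Ico 0 T) :
    Periodic (logDensity ρ t) := fun x k => by
  simp only [logDensity, h.periodic_density t ht x k]

lemma IsSmoothSolution.hasDerivAt_density (h : IsSmoothSolution ν κ γ T ρ u)
    (ht : t ∈ Set.Ioo 0 T) (x : Space) :
    HasDerivAt (fun s => ρ s x)
      (Real.exp (logDensity ρ t x) * timeDeriv T (logDensity ρ) t x) t := by
  refine ((h.smooth_log.hasDerivAt ht x).exp).congr_of_eventuallyEq ?_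
  filter_upwards [Ico_mem_nhds ht.1 ht.2] with s hs using h.density_eq hs x

lemma IsSmoothSolution.timeDeriv_log (h : IsSmoothSolution ν κ γ T ρ u)
    (ht : t ∈ Set.Ioo 0 T) (x : Space) :
    timeDeriv T (logDensity ρ) t x
      = -∑ j, (u t x j * pd j (logDensity ρ t) x + jac (u t) x j j) := by
  have ht' : t ∈ Set.Ico 0 T := ⟨ht.1.le, ht.2⟩
  have hL := h.smooth_log.slice ht'
  have hu := h.slice_velocity ht'
  have hc := h.continuity_eq t ht x
  rw [(h.hasDerivAt_density ht x).deriv] at hc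
  have hd : divergence (fun y => ρ t y • u t y) x = Real.exp (logDensity ρ t x)
      * ∑ j, (u t x j * pd j (logDensity ρ t) x + jac (u t) x j j) := by
    rw [divergence, Finset.mul_sum]
    refine Finset.sum_congr rfl fun j _ => ?_
    have dρ : HasPD j (fun y => Real.exp (logDensity ρ t y)) _ x :=
      HasPD.comp (Real.hasDerivAt_exp _) (hasPD_of_contDiff hL)
    have := (dρ.mul (hasPD_of_contDiff (contDiff_coord hu j))).2
    simp only [Pi.smul_apply, smul_eq_mul, h.density_eq ht', this, jac]
    ring
  rw [hd, ← mul_add] at hc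
  have := (mul_eq_zero.1 hc).resolve_left (Real.exp_ne_zero _)
  linarith

lemma IsSmoothSolution.pd_timeDeriv_log (h : IsSmoothSolution ν κ γ T ρ u)
    (ht : t ∈ Set.Ioo 0 T) (i : Fin 3) (x : Space) :
    pd i (timeDeriv T (logDensity ρ) t) x
      = -∑ j, (jac (u t) x j i * pd j (logDensity ρ t) x
        + u t x j * pd i (pd j (logDensity ρ t)) x + pd i (pd j fun y => u t y j) x) := by
  have ht' : t ∈ Set.Ico 0 T := ⟨ht.1.le, ht.2⟩
  have hL := h.smooth_log.slice ht'
  have hu := h.slice_velocity ht'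
  rw [show timeDeriv T (logDensity ρ) t = _ from funext fun x => h.timeDeriv_log ht x]
  have d := HasPD.neg (HasPD.sum fun j =>
    ((hasPD_of_contDiff (j := i) (x := x) (contDiff_coord hu j)).mul
      (hasPD_of_contDiff (contDiff_pd (j := j) hL))).add
        (hasPD_of_contDiff (contDiff_jac hu j j)))
  exact d.2

/-- The momentum equation in nonconservative form. -/
lemma IsSmoothSolution.timeDeriv_velocity (h : IsSmoothSolution ν κ γ T ρ u)
    (ht : t ∈ Set.Ioo 0 T) (i : Fin 3) (x : Space) :
    timeDeriv T (fun s y => u s y i) t x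
      = -(γ * Real.exp ((γ - 1) * logDensity ρ t x) * pd i (logDensity ρ t) x)
        + ∑ j, (-(u t x j * jac (u t) x i j)
          + 2 * ν * ((pd j (pd j fun y => u t y i) x + pd j (pd i fun y => u t y j) x) / 2
            + symGrad (u t) x i j * pd j (logDensity ρ t) x)
          + κ ^ 2 * (pd i (pd j (pd j (logDensity ρ t))) x
            + pd j (logDensity ρ t) x * pd i (pd j (logDensity ρ t)) x)) := by
  have ht' : t ∈ Set.Ico 0 T := ⟨ht.1.le, ht.2⟩
  have hL := h.smooth_log.slice ht'
  have hu := h.slice_velocity ht'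
  have hρ : ρ t = fun y => Real.exp (logDensity ρ t y) := funext fun y => h.density_eq ht' y
  have hm := h.momentum_eq t ht x i
  have hLt := h.timeDeriv_log ht x
  have hmul : deriv (fun s => ρ s x * u s x i) t = _ :=
    ((h.hasDerivAt_density ht x).mul ((h.smooth_coord i).hasDerivAt ht x)).deriv
  rw [hmul] at hm
  rw [hρ] at hm
  set L := logDensity ρ t with hLdef
  have dρ : ∀ j, HasPD j (fun y => Real.exp (L y)) (Real.exp (L x) * pd j L x) x := fun j =>
    HasPD.comp (Real.hasDerivAt_exp _) (hasPD_of_contDiff hL)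
  have du : ∀ j k, HasPD j (fun y => u t y k) (jac (u t) x k j) x := fun j k =>
    hasPD_of_contDiff (contDiff_coord hu k)
  have e1 : ∀ j, pd j (fun y => Real.exp (L y) * u t y i * u t y j) x
      = Real.exp (L x) * (pd j L x * u t x i * u t x j + jac (u t) x i j * u t x j
        + u t x i * jac (u t) x j j) := fun j => by
    rw [(((dρ j).mul (du j i)).mul (du j j)).2]; ring
  have e2 : pd i (fun y => Real.exp (L y) ^ γ) x
      = Real.exp (L x) * (γ * Real.exp ((γ - 1) * L x) * pd i L x) := by
    have e : (fun y => Real.exp (L y) ^ γ) = fun y => Real.exp (γ * L y) := by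
      ext y; rw [← Real.exp_mul, mul_comm]
    have d : HasPD i (fun y => Real.exp (γ * L y)) _ x :=
      HasPD.comp (Real.hasDerivAt_exp _) ((hasPD_of_contDiff hL).const_mul γ)
    rw [e, d.2, exp_mul_exp_sub_one]; ring
  have e3 : ∀ j, pd j (fun y => Real.exp (L y) * symGrad (u t) y i j) x
      = Real.exp (L x) * ((pd j (pd j fun y => u t y i) x + pd j (pd i fun y => u t y j) x) / 2
            + symGrad (u t) x i j * pd j L x) := fun j => by
    have dS : HasPD j (fun y => symGrad (u t) y i j)
        ((pd j (pd j fun y => u t y i) x + pd j (pd i fun y => u t y j) x) / 2) x := by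
      have dJ : ∀ k l, HasPD j (fun y => jac (u t) y k l) (pd j (pd l fun y => u t y k) x) x :=
        fun k l => hasPD_of_contDiff (contDiff_jac hu k l)
      have := ((dJ i j).add (dJ j i)).const_mul (1 / 2)
      have e : (fun y => symGrad (u t) y i j)
          = fun y => 1 / 2 * (jac (u t) y i j + jac (u t) y j i) := by
        ext y; simp only [symGrad]; ring
      rw [e]
      exact this.congr_val (by ring)
    rw [((dρ j).mul dS).2]; ring
  simp only [e1, e2, e3, pd_bohm hL, hLt, ← Finset.mul_sum] at hm
  -- The continuity equation, already substituted through `hLt`, cancels the terms in which u is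
  -- multiplied by ∂ₜρ + div(ρu). Every remaining term has the positive factor ρ.
  have key : Real.exp (L x) * (timeDeriv T (fun s y => u s y i) t x
      - (-(γ * Real.exp ((γ - 1) * L x) * pd i L x)
        + ∑ j, (-(u t x j * jac (u t) x i j)
          + 2 * ν * ((pd j (pd j fun y => u t y i) x + pd j (pd i fun y => u t y j) x) / 2
            + symGrad (u t) x i j * pd j L x)
          + κ ^ 2 * (pd i (pd j (pd j L)) x + pd j L x * pd i (pd j L) x)))) = 0 := by
    rw [← hm]
    simp only [Fin.sum_univ_three]
    ring
  have := (mul_eq_zero.1 key).resolve_left (Real.exp_ne_zero _)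
  linarith

end Solution

end QNS

/-! ### Equations for the effective velocity and balances along solutions -/

namespace QNS

/-- The effective velocity `u + μ ∇ log ρ` as a function of time. -/
noncomputable def effVel (ν κ : ℝ) (ρ : ℝ → Space → ℝ) (u : ℝ → Space → Space) (s : ℝ) :
    Space → Space :=
  effVelocity (mu ν κ) (ρ s) (u s)

section Solution

variable {ν κ γ T t : ℝ} {ρ : ℝ → Space → ℝ} {u : ℝ → Space → Space}

lemma IsSmoothSolution.smooth_effVel (h : IsSmoothSolution ν κ γ T ρ u) (i : Fin 3) :
    SlabSmooth T fun s x => effVel ν κ ρ u s x i :=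
  ContDiffOn.add (h.smooth_coord i) (contDiffOn_const.mul (h.smooth_log.pd i))

lemma IsSmoothSolution.slice_effVel (h : IsSmoothSolution ν κ γ T ρ u)
    (ht : t ∈ Set.Ico 0 T) : ContDiff ℝ ∞ (effVel ν κ ρ u t) :=
  contDiff_pi.2 fun i => (h.smooth_effVel i).slice ht

lemma IsSmoothSolution.periodic_effVel (h : IsSmoothSolution ν κ γ T ρ u)
    (ht : t ∈ Set.Ico 0 T) : Periodic (effVel ν κ ρ u t) := fun x k => by
  ext i
  have := (h.periodic_log ht).pd i x k
  simp only [effVel, effVelocity, h.periodic_velocity t ht x k]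
  congr 2

lemma IsSmoothSolution.jac_effVel (h : IsSmoothSolution ν κ γ T ρ u) (ht : t ∈ Set.Ico 0 T)
    (i j : Fin 3) (x : Space) :
    jac (effVel ν κ ρ u t) x i j
      = jac (u t) x i j + mu ν κ * pd j (pd i (logDensity ρ t)) x :=
  ((hasPD_of_contDiff (contDiff_coord (h.slice_velocity ht) i)).add
    ((hasPD_of_contDiff (contDiff_pd (h.smooth_log.slice ht))).const_mul (mu ν κ))).2

lemma IsSmoothSolution.pd_jac_effVel (h : IsSmoothSolution ν κ γ T ρ u) (ht : t ∈ Set.Ico 0 T)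
    (i j k : Fin 3) (x : Space) :
    pd k (pd j fun y => effVel ν κ ρ u t y i) x
      = pd k (pd j fun y => u t y i) x + mu ν κ * pd k (pd j (pd i (logDensity ρ t))) x := by
  have e : (pd j fun y => effVel ν κ ρ u t y i)
      = fun y => jac (u t) y i j + mu ν κ * pd j (pd i (logDensity ρ t)) y :=
    funext fun y => h.jac_effVel ht i j y
  rw [e]
  exact ((hasPD_of_contDiff (contDiff_jac (h.slice_velocity ht) i j)).add
    ((hasPD_of_contDiff (contDiff_pd (contDiff_pd (h.smooth_log.slice ht)))).const_mul _)).2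

lemma IsSmoothSolution.timeDeriv_log_eq_rate (h : IsSmoothSolution ν κ γ T ρ u)
    (ht : t ∈ Set.Ioo 0 T) (x : Space) :
    timeDeriv T (logDensity ρ) t x
      = logDensityRate (mu ν κ) (logDensity ρ t) (effVel ν κ ρ u t) x := by
  have ht' : t ∈ Set.Ico 0 T := ⟨ht.1.le, ht.2⟩
  have e : ∀ j, effVel ν κ ρ u t x j = u t x j + mu ν κ * pd j (logDensity ρ t) x := fun _ => rfl
  simp only [h.timeDeriv_log ht, logDensityRate, h.jac_effVel ht', e, Fin.sum_univ_three]
  ring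

/-- Add μ∇ of the equation for log ρ to the nonconservative momentum equation. The term μ∇div u and
its first-order companions turn part of the symmetric viscosity into the full diffusion with
coefficient μ, leaving 2λ in front of the symmetric part. -/
lemma IsSmoothSolution.hasDerivAt_effVel (hκ : 0 < κ) (hκν : κ < ν)
    (h : IsSmoothSolution ν κ γ T ρ u) (ht : t ∈ Set.Ioo 0 T) (i : Fin 3) (x : Space) :
    HasDerivAt (fun s => effVel ν κ ρ u s x i)
      (velocityRate (mu ν κ) (lam ν κ) γ (logDensity ρ t) (effVel ν κ ρ u t) x i) t := by
  have ht' : t ∈ Set.Ico 0 T := ⟨ht.1.le, ht.2⟩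
  have hL := h.smooth_log.slice ht'
  have hu := h.slice_velocity ht'
  refine (((h.smooth_coord i).hasDerivAt ht x).add
    ((h.smooth_log.hasDerivAt_pd ht i x).const_mul (mu ν κ))).congr_deriv ?_
  rw [h.timeDeriv_velocity ht, h.pd_timeDeriv_log ht, velocityRate, mul_neg, Finset.mul_sum,
    Finset.mul_sum, Finset.mul_sum, ← sub_eq_zero]
  -- The pressure terms already agree on both sides; the rest is matched summand by summand in j.
  have key : ∀ j, (-(u t x j * jac (u t) x i j)
          + 2 * ν * ((pd j (pd j fun y => u t y i) x + pd j (pd i fun y => u t y j) x) / 2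
            + symGrad (u t) x i j * pd j (logDensity ρ t) x)
          + κ ^ 2 * (pd i (pd j (pd j (logDensity ρ t))) x
            + pd j (logDensity ρ t) x * pd i (pd j (logDensity ρ t)) x))
      - mu ν κ * (jac (u t) x j i * pd j (logDensity ρ t) x
        + u t x j * pd i (pd j (logDensity ρ t)) x + pd i (pd j fun y => u t y j) x)
      = -(effVel ν κ ρ u t x j * jac (effVel ν κ ρ u t) x i j)
        + 2 * lam ν κ * ((pd j (pd j fun y => effVel ν κ ρ u t y i) x
            + pd j (pd i fun y => effVel ν κ ρ u t y j) x) / 2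
          + symGrad (effVel ν κ ρ u t) x i j * pd j (logDensity ρ t) x)
        + mu ν κ * (2 * pd j (logDensity ρ t) x * jac (effVel ν κ ρ u t) x i j
          + pd j (pd j fun y => effVel ν κ ρ u t y i) x) := by
    intro j
    have e : effVel ν κ ρ u t x j = u t x j + mu ν κ * pd j (logDensity ρ t) x := rfl
    have s1 : pd j (pd i (logDensity ρ t)) = pd i (pd j (logDensity ρ t)) :=
      funext fun y => pd_comm hL j i y
    have s2 : pd j (pd i (pd j (logDensity ρ t))) x = pd i (pd j (pd j (logDensity ρ t))) x :=
      pd_comm (contDiff_pd hL) j i x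
    have s3 : pd j (pd i fun y => u t y j) x = pd i (pd j fun y => u t y j) x :=
      pd_comm (contDiff_coord hu j) j i x
    simp only [symGrad, h.jac_effVel ht', h.pd_jac_effVel ht', e, s1, s2, s3]
    -- The first multiple replaces ν by μ + λ in the viscous terms; the second replaces κ² by μ² +
    -- 2λμ in the quantum terms.
    linear_combination -(2 * ((pd j (pd j fun y => u t y i) x
          + pd i (pd j fun y => u t y j) x) / 2
        + (jac (u t) x i j + jac (u t) x j i) / 2 * pd j (logDensity ρ t) x)) * mu_add_lam ν κ
      - (pd i (pd j (pd j (logDensity ρ t))) x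
        + pd j (logDensity ρ t) x * pd i (pd j (logDensity ρ t)) x) * mu_sq_add hκ hκν
  have hs := Finset.sum_congr (rfl : (Finset.univ : Finset (Fin 3)) = _) fun j _ => key j
  simp only [Finset.sum_sub_distrib, Finset.sum_add_distrib, Finset.sum_neg_distrib] at hs ⊢
  linear_combination hs

/-- The entropy balance: time derivative of `∫ ρ h(|w|²/2)`. -/
theorem IsSmoothSolution.hasDerivAt_entropy (hκ : 0 < κ) (hκν : κ < ν)
    (h : IsSmoothSolution ν κ γ T ρ u) (ht : t ∈ Set.Ioo 0 T)
    {f f1 f2 : ℝ → ℝ} (hf : TwiceDiff f f1 f2) :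
    HasDerivAt (fun s => ∫ x in cube, ρ s x * f (normSq (effVel ν κ ρ u s x) / 2))
      (∫ x in cube, entropyProduction (mu ν κ) (lam ν κ) γ f1 f2 (logDensity ρ t)
        (effVel ν κ ρ u t) x) t := by
  have ht' : t ∈ Set.Ico 0 T := ⟨ht.1.le, ht.2⟩
  have hφ : SlabSmooth T fun s x => normSq (effVel ν κ ρ u s x) / 2 :=
    ContDiffOn.div_const (ContDiffOn.sum fun i _ => (h.smooth_effVel i).pow 2) 2
  have hfφ : SlabSmooth T fun s x => f (normSq (effVel ν κ ρ u s x) / 2) :=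
    hf.smooth.comp hφ fun p _ => show (-1 : ℝ) < _ by
      linarith [normSq_nonneg (effVel ν κ ρ u p.1 p.2)]
  have hF : SlabSmooth T fun s x => ρ s x * f (normSq (effVel ν κ ρ u s x) / 2) :=
    ContDiffOn.mul h.smooth_density hfφ
  refine (hF.hasDerivAt_integral ht).congr_deriv ?_
  rw [← integral_entropy_balance _ _ _ hf (h.smooth_log.slice ht') (h.slice_effVel ht')
    (h.periodic_log ht') (h.periodic_effVel ht')]
  refine integral_congr_ae (Eventually.of_forall fun x => ?_)
  -- By uniqueness of derivatives, the abstract time derivative equals the one given by the product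
  -- and chain rules.
  refine (hF.hasDerivAt ht x).unique ?_
  have hφ0 : (-1 : ℝ) < normSq (effVel ν κ ρ u t x) / 2 := by
    linarith [normSq_nonneg (effVel ν κ ρ u t x)]
  have dφ : HasDerivAt (fun s => normSq (effVel ν κ ρ u s x) / 2)
      (∑ i, effVel ν κ ρ u t x i *
        velocityRate (mu ν κ) (lam ν κ) γ (logDensity ρ t) (effVel ν κ ρ u t) x i) t := by
    have := (HasDerivAt.fun_sum fun i (_ : i ∈ Finset.univ) =>
      (h.hasDerivAt_effVel hκ hκν ht i x).pow 2).div_const 2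
    refine this.congr_deriv ?_
    rw [Finset.sum_div]
    exact Finset.sum_congr rfl fun i _ => by push_cast; ring
  have dρ := h.hasDerivAt_density ht x
  rw [h.timeDeriv_log_eq_rate ht] at dρ
  refine (dρ.mul ((hf.deriv_zero _ hφ0).comp t dφ)).congr_deriv ?_
  rw [h.density_eq ht']
  simp only [Function.comp_apply]
  ring

/-- The time derivative of `∫ ρ^γ`. -/
theorem IsSmoothSolution.hasDerivAt_pressure
    (h : IsSmoothSolution ν κ γ T ρ u) (ht : t ∈ Set.Ioo 0 T) :
    HasDerivAt (fun s => ∫ x in cube, ρ s x ^ γ)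
      (∫ x in cube, (γ - 1) * (-(Real.exp (γ * logDensity ρ t x)
          * divergence (effVel ν κ ρ u t) x)
        - mu ν κ * γ * (Real.exp (γ * logDensity ρ t x)
          * ∑ j, pd j (logDensity ρ t) x ^ 2))) t := by
  have ht' : t ∈ Set.Ico 0 T := ⟨ht.1.le, ht.2⟩
  have hF : SlabSmooth T fun s x => ρ s x ^ γ :=
    ContDiffOn.rpow_const_of_ne h.smooth_density fun p hp => (h.density_pos p.1 hp.1 p.2).ne'
  refine (hF.hasDerivAt_integral ht).congr_deriv ?_
  rw [← integral_pressure_balance _ _ (h.smooth_log.slice ht') (h.slice_effVel ht')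
    (h.periodic_log ht') (h.periodic_effVel ht')]
  refine integral_congr_ae (Eventually.of_forall fun x => ?_)
  refine (hF.hasDerivAt ht x).unique ?_
  have d := ((h.smooth_log.hasDerivAt ht x).const_mul γ).exp
  rw [h.timeDeriv_log_eq_rate ht] at d
  refine (d.congr_of_eventuallyEq ?_).congr_deriv (by ring)
  filter_upwards [Ico_mem_nhds ht.1 ht.2] with s hs
  rw [h.density_eq hs x, ← Real.exp_mul, mul_comm]

end Solution

end QNS

/-! ### The logarithmic entropy identity -/

namespace QNS

lemma twiceDiff_mul_log : TwiceDiff (fun y => (1 + y) * Real.log (1 + y))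
    (fun y => 1 + Real.log (1 + y)) (fun y => (1 + y)⁻¹) where
  deriv_zero y hy := by
    have hy' : 1 + y ≠ 0 := by linarith
    have h1 : HasDerivAt (fun y : ℝ => 1 + y) 1 y := (hasDerivAt_id y).const_add 1
    refine (h1.mul (h1.log hy')).congr_deriv ?_
    field_simp
    ring
  deriv_one y hy := by
    have hy' : 1 + y ≠ 0 := by linarith
    have h1 : HasDerivAt (fun y : ℝ => 1 + y) 1 y := (hasDerivAt_id y).const_add 1
    exact ((h1.log hy').const_add 1).congr_deriv (one_div _)
  smooth := by
    have h1 : ContDiffOn ℝ ∞ (fun y : ℝ => 1 + y) (Set.Ioi (-1)) := by fun_prop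
    exact h1.mul (h1.log fun y hy => by
      have : -1 < y := hy
      linarith)
  cont := by
    refine ContinuousOn.inv₀ (by fun_prop) fun y hy => ?_
    have : -1 < y := hy
    linarith

/-- This choice of h produces the kinetic energy; as h'' = 0, the trilinear terms disappear. -/
lemma twiceDiff_id : TwiceDiff (fun y => y) (fun _ => 1) (fun _ => 0) where
  deriv_zero y _ := hasDerivAt_id y
  deriv_one y _ := hasDerivAt_const y 1
  smooth := contDiffOn_id
  cont := continuousOn_const

lemma two_div_two_add (a : Space) : 2 / (2 + normSq a) = (1 + normSq a / 2)⁻¹ := by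
  have := normSq_nonneg a
  field_simp

section Continuity

variable {w : Space → Space}

@[fun_prop]
lemma continuous_logTerm (hw : ContDiff ℝ ∞ w) : Continuous fun x => logTerm w x :=
  continuous_comp_kinetic (h := fun y => Real.log (1 + y)) (fun y hy =>
    (Real.continuousAt_log (by have : -1 < y := hy; linarith)).comp_continuousWithinAt
      (f := fun y : ℝ => 1 + y) (by fun_prop)) hw

lemma continuous_two_div (hw : ContDiff ℝ ∞ w) : Continuous fun x => 2 / (2 + normSq (w x)) :=
  continuous_const.div (by fun_prop) fun x => by linarith [normSq_nonneg (w x)]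

lemma normSq_grad_kinetic (hw : ContDiff ℝ ∞ w) (x : Space) :
    normSq (grad (fun y => normSq (w y) / 2) x) = ∑ j, (∑ k, w x k * jac w x k j) ^ 2 := by
  simp only [normSq, grad]
  exact Finset.sum_congr rfl fun j _ => by rw [← (hasPD_kinetic hw j x).2]; rfl

end Continuity

/-- The entropy identity for smooth solutions. -/
theorem IsSmoothSolution.mvIdentity {ν κ γ T t : ℝ} {ρ : ℝ → Space → ℝ}
    {u : ℝ → Space → Space} (hκ : 0 < κ) (hκν : κ < ν) (h : IsSmoothSolution ν κ γ T ρ u)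
    (ht : t ∈ Set.Ioo 0 T) :
    MVIdentityAt (mu ν κ) (lam ν κ) γ ρ (effVel ν κ ρ u) t := by
  have ht' : t ∈ Set.Ico 0 T := ⟨ht.1.le, ht.2⟩
  refine ⟨_, (h.hasDerivAt_entropy hκ hκν ht twiceDiff_mul_log).congr_of_eventuallyEq
    (Eventually.of_forall fun s => ?_), ?_⟩
  · simp only [mvEntropy, logTerm, mul_assoc]
  set w := effVel ν κ ρ u t with hwdef
  have hw : ContDiff ℝ ∞ w := h.slice_effVel ht'
  have hρ : Continuous (ρ t) := (SlabSmooth.slice h.smooth_density ht').continuous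
  have hργ : Continuous fun x => ρ t x ^ γ :=
    hρ.rpow_const fun x => Or.inl (h.density_pos t ht' x).ne'
  have cw := hw.continuous
  have c2 := continuous_two_div hw
  have eγ : ∀ x, Real.exp (γ * logDensity ρ t x) = ρ t x ^ γ := fun x => by
    rw [h.density_eq ht' x, ← Real.exp_mul, mul_comm]
  -- The summand 1 in h' = 1 + log separates each quadratic dissipation into a plain and a
  -- logarithmic part, and h'' becomes 2/(2+|w|²).
  have hp : ∀ x, entropyProduction (mu ν κ) (lam ν κ) γ (fun y => 1 + Real.log (1 + y))
      (fun y => (1 + y)⁻¹) (logDensity ρ t) w x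
      = -mu ν κ * (ρ t x * ∑ i, ∑ j, jac w x i j ^ 2)
        + -mu ν κ * (ρ t x * (∑ i, ∑ j, jac w x i j ^ 2) * logTerm w x)
        + -(2 * lam ν κ) * (ρ t x * ∑ i, ∑ j, symGrad w x i j ^ 2)
        + -(2 * lam ν κ) * (ρ t x * (∑ i, ∑ j, symGrad w x i j ^ 2) * logTerm w x)
        + -mu ν κ * (ρ t x * (∑ j, (∑ k, w x k * jac w x k j) ^ 2)
          * (2 / (2 + normSq (w x))))
        + -(2 * lam ν κ) * (ρ t x *
          (∑ i, ∑ j, ∑ k, symGrad w x i j * w x i * jac w x k j * w x k)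
          * (2 / (2 + normSq (w x))))
        + ρ t x ^ γ * divergence w x * (1 + logTerm w x)
        + ρ t x ^ γ * (∑ i, ∑ k, w x i * jac w x k i * w x k) * (2 / (2 + normSq (w x))) := by
    intro x
    simp only [entropyProduction, two_div_two_add, eγ, ← h.density_eq ht', logTerm]
    ring
  simp only [normSq_grad_kinetic hw]
  rw [integral_congr_ae (Eventually.of_forall hp)]
  rw [integral_add (integrableOn_cube (by fun_prop)) (integrableOn_cube (by fun_prop)),
    integral_add (integrableOn_cube (by fun_prop)) (integrableOn_cube (by fun_prop)),
    integral_add (integrableOn_cube (by fun_prop)) (integrableOn_cube (by fun_prop)),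
    integral_add (integrableOn_cube (by fun_prop)) (integrableOn_cube (by fun_prop)),
    integral_add (integrableOn_cube (by fun_prop)) (integrableOn_cube (by fun_prop)),
    integral_add (integrableOn_cube (by fun_prop)) (integrableOn_cube (by fun_prop)),
    integral_add (integrableOn_cube (by fun_prop)) (integrableOn_cube (by fun_prop))]
  simp only [integral_const_mul]
  ring

end QNS

/-! ### Sobolev inequality on the torus -/

namespace QNS

open scoped ENNReal NNReal

lemma Periodic.add_intCast {α : Type*} {f : Space → α} (hf : Periodic f) (z : Fin 3 → ℤ)
    (x : Space) : f (x + fun i => (z i : ℝ)) = f x := by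
  have h : ∀ (i : Fin 3) (n : ℤ) (y : Space), f (y + n • Pi.single i 1) = f y := fun i n y =>
    Function.Periodic.zsmul (fun y => hf y i) n y
  have e : (x + fun i => (z i : ℝ))
      = x + z 0 • Pi.single 0 1 + z 1 • Pi.single 1 1 + z 2 • Pi.single 2 1 := by
    ext i
    fin_cases i <;> simp
  rw [e, h, h, h]

/-- Integrals of a periodic function over a box of side three. -/
lemma lintegral_box_le {F : Space → ℝ≥0∞} (hF : Periodic F)
    (hm : Measurable F) :
    ∫⁻ x in Set.Icc (fun _ : Fin 3 => (-1 : ℝ)) (fun _ => 2), F x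
      ≤ 27 * ∫⁻ x in cube, F x := by
  set H := cube.indicator F with hH
  -- The box [-1, 2]³ is covered by the 27 unit cubes shifted by k - 1 with k ∈ {0, 1, 2}³. Overlaps
  -- on faces do no harm to the upper bound.
  have hle : ∀ x, (Set.Icc (fun _ : Fin 3 => (-1 : ℝ)) (fun _ => 2)).indicator F x
      ≤ ∑ k : Fin 3 → Fin 3, H (x - fun i => ((k i : ℕ) : ℝ) - 1) := by
    intro x
    by_cases hx : x ∈ Set.Icc (fun _ : Fin 3 => (-1 : ℝ)) (fun _ => 2)
    swap
    · simp [Set.indicator_of_notMem hx]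
    rw [Set.indicator_of_mem hx]
    have hk : ∀ i, ∃ k : Fin 3, x i - (((k : ℕ) : ℝ) - 1) ∈ Set.Icc (0 : ℝ) 1 := by
      intro i
      have h1 : -1 ≤ x i := hx.1 i
      have h2 : x i ≤ 2 := hx.2 i
      rcases le_total (x i) 0 with h | h
      · exact ⟨0, by simp; constructor <;> linarith⟩
      rcases le_total (x i) 1 with h' | h'
      · exact ⟨1, by simp; constructor <;> linarith⟩
      · exact ⟨2, by norm_num; constructor <;> linarith⟩
    choose k hk using hk
    have hmem : (x - fun i => ((k i : ℕ) : ℝ) - 1) ∈ cube :=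
      ⟨fun i => (hk i).1, fun i => (hk i).2⟩
    have hper : F (x - fun i => ((k i : ℕ) : ℝ) - 1) = F x := by
      have := hF.add_intCast (fun i => 1 - ((k i : ℕ) : ℤ)) x
      rw [← this]
      congr 1
      ext i
      simp
      ring
    calc F x = H (x - fun i => ((k i : ℕ) : ℝ) - 1) := by
          rw [hH, Set.indicator_of_mem hmem, hper]
      _ ≤ _ := Finset.single_le_sum
          (f := fun k : Fin 3 → Fin 3 => H (x - fun i => ((k i : ℕ) : ℝ) - 1))
          (fun _ _ => zero_le) (Finset.mem_univ k)
  have hHm : Measurable H := hm.indicator measurableSet_cube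
  calc ∫⁻ x in Set.Icc (fun _ : Fin 3 => (-1 : ℝ)) (fun _ => 2), F x
      = ∫⁻ x, (Set.Icc (fun _ : Fin 3 => (-1 : ℝ)) (fun _ => 2)).indicator F x :=
        (lintegral_indicator measurableSet_Icc F).symm
    _ ≤ ∫⁻ x, ∑ k : Fin 3 → Fin 3, H (x - fun i => ((k i : ℕ) : ℝ) - 1) := lintegral_mono hle
    _ = ∑ k : Fin 3 → Fin 3, ∫⁻ x, H (x - fun i => ((k i : ℕ) : ℝ) - 1) :=
        lintegral_finsetSum _ fun k _ => hHm.comp (measurable_id.sub_const _)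
    _ = ∑ _k : Fin 3 → Fin 3, ∫⁻ x in cube, F x := by
        refine Finset.sum_congr rfl fun k _ => ?_
        rw [lintegral_sub_right_eq_self H, hH, lintegral_indicator measurableSet_cube]
    _ = 27 * ∫⁻ x in cube, F x := by simp

lemma norm_fderiv_le (f : Space → ℝ) (x : Space) : ‖fderiv ℝ f x‖ ≤ ∑ i, |pd i f x| := by
  refine ContinuousLinearMap.opNorm_le_bound _ (Finset.sum_nonneg fun i _ => abs_nonneg _)
    fun v => ?_
  have hv : v = ∑ i, v i • (Pi.single i 1 : Space) := by
    ext j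
    simp [Finset.sum_apply, Pi.single_apply]
  conv_lhs => rw [hv]
  rw [map_sum, Finset.sum_mul]
  refine (norm_sum_le _ _).trans (Finset.sum_le_sum fun i _ => ?_)
  rw [map_smul, smul_eq_mul, norm_mul, mul_comm]
  exact mul_le_mul_of_nonneg_left (norm_le_pi_norm v i) (abs_nonneg _)

/-- The Sobolev inequality `‖f‖₆ ≤ C ‖f‖_{H¹}` on the torus. -/
theorem exists_sobolev_const : ∃ C : ℝ, 0 ≤ C ∧ ∀ f : Space → ℝ, ContDiff ℝ ∞ f → Periodic f →
    ∫ x in cube, f x ^ 6 ≤ C * (∫ x in cube, (f x ^ 2 + normSq (grad f x))) ^ 3 := by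
  -- In the supremum norm the balls of radius 1/2 and 3/2 about the centre are the unit cube and
  -- [-1, 2]³. So χ = 1 on the cube, and χf is a compactly supported function to which the
  -- whole-space inequality applies.
  obtain ⟨χ, hχin, hχout⟩ : ∃ χ : ContDiffBump (fun _ : Fin 3 => (1 / 2 : ℝ)),
      χ.rIn = 1 / 2 ∧ χ.rOut = 3 / 2 :=
    ⟨⟨1 / 2, 3 / 2, by norm_num, by norm_num⟩, rfl, rfl⟩
  have hχ : ContDiff ℝ 1 χ := χ.contDiff
  have hχs : HasCompactSupport χ := χ.hasCompactSupport
  obtain ⟨B, hB⟩ := (hχs.fderiv (𝕜 := ℝ)).exists_bound_of_continuous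
    (hχ.continuous_fderiv (by simp))
  set K : ℝ≥0 := SNormLESNormFDerivOfEqConst ℝ (volume : Measure Space) (2 : ℝ≥0) with hK
  -- Here `K` is the whole-space constant, 27 counts the unit cells of the box, and 4(1 + B²) bounds
  -- |∇(χf)|² by f² + |∇f|² when |∇χ| ≤ B. The powers come from writing ‖∇(χf)‖₂⁶ as (‖∇(χf)‖₂²)³.
  refine ⟨(K : ℝ) ^ 6 * (27 * (4 * (1 + B ^ 2))) ^ 3, by positivity, fun f hf pf => ?_⟩
  set v : Space → ℝ := fun x => χ x * f x with hv
  have hf1 : ContDiff ℝ 1 f := hf.of_le (by simp)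
  have hv1 : ContDiff ℝ 1 v := hχ.mul hf1
  have hvs : HasCompactSupport v := hχs.mul_right
  set g : Space → ℝ := fun x => f x ^ 2 + normSq (grad f x) with hg
  have hg0 : ∀ x, 0 ≤ g x := fun x => add_nonneg (sq_nonneg _) (normSq_nonneg _)
  have hgc : Continuous g := by
    have := hf.continuous
    simp only [hg, normSq, grad]
    fun_prop
  have hgp : Periodic g := fun x k => by
    have : grad f (x + Pi.single k 1) = grad f x := funext fun i => pf.pd i x k
    simp only [hg, pf x k, this]
  -- The exponents are related by 1/6 = 1/2 - 1/3 in dimension three.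
  have hsob := eLpNorm_le_eLpNorm_fderiv_of_eq (volume : Measure Space) hv1 hvs (p := 2) (p' := 6)
    (by norm_num) (by simp) (by simp; norm_num)
  have h6 := eLpNorm_nnreal_pow_eq_lintegral (f := v) (μ := (volume : Measure Space))
    (p := 6) (by norm_num)
  have h2 := eLpNorm_nnreal_pow_eq_lintegral (f := fderiv ℝ v) (μ := (volume : Measure Space))
    (p := 2) (by norm_num)
  simp only [NNReal.coe_ofNat, ENNReal.rpow_ofNat] at h6 h2
  have hbound : ∀ x, ‖fderiv ℝ v x‖ₑ ^ 2
      ≤ (Set.Icc (fun _ : Fin 3 => (-1 : ℝ)) (fun _ => 2)).indicator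
        (fun x => ENNReal.ofReal (4 * (1 + B ^ 2) * g x)) x := by
    intro x
    by_cases hx : x ∈ Set.Icc (fun _ : Fin 3 => (-1 : ℝ)) (fun _ => 2)
    · rw [Set.indicator_of_mem hx, ← ofReal_norm, ← ENNReal.ofReal_pow (norm_nonneg _)]
      refine ENNReal.ofReal_le_ofReal ?_
      have hd : fderiv ℝ v x = χ x • fderiv ℝ f x + f x • fderiv ℝ χ x :=
        fderiv_fun_mul (hχ.differentiable (by simp) x) (hf1.differentiable (by simp) x)
      have h1 : ‖fderiv ℝ v x‖ ≤ ∑ i, |pd i f x| + |f x| * B := by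
        rw [hd]
        refine (norm_add_le _ _).trans (add_le_add ?_ ?_)
        · rw [norm_smul, Real.norm_eq_abs, abs_of_nonneg χ.nonneg]
          exact (mul_le_of_le_one_left (norm_nonneg _) χ.le_one).trans (norm_fderiv_le f x)
        · rw [norm_smul]
          exact mul_le_mul_of_nonneg_left (hB x) (norm_nonneg _)
      refine (pow_le_pow_left₀ (norm_nonneg _) h1 2).trans ?_
      simp only [hg, normSq, grad, Fin.sum_univ_three]
      have a0 := sq_abs (pd 0 f x)
      have a1 := sq_abs (pd 1 f x)
      have a2 := sq_abs (pd 2 f x)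
      have a3 := sq_abs (f x)
      rw [← a0, ← a1, ← a2, ← a3]
      generalize |pd 0 f x| = p
      generalize |pd 1 f x| = q
      generalize |pd 2 f x| = r
      generalize |f x| = s
      have e1 : (p + q + r + s * B) ^ 2 ≤ 4 * (p ^ 2 + q ^ 2 + r ^ 2 + (s * B) ^ 2) := by
        nlinarith [sq_nonneg (p - q), sq_nonneg (p - r), sq_nonneg (q - r),
          sq_nonneg (p - s * B), sq_nonneg (q - s * B), sq_nonneg (r - s * B)]
      refine e1.trans ?_
      nlinarith [mul_nonneg (sq_nonneg B) (sq_nonneg p), mul_nonneg (sq_nonneg B) (sq_nonneg q),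
        mul_nonneg (sq_nonneg B) (sq_nonneg r), sq_nonneg s]
    · have hx' : x ∉ tsupport v := fun h => by
        have hx2 : x ∈ tsupport χ := closure_mono (Function.support_mul_subset_left _ _) h
        rw [χ.tsupport_eq, hχout, Metric.mem_closedBall, dist_pi_le_iff (by norm_num)] at hx2
        refine hx ⟨fun i => ?_, fun i => ?_⟩ <;>
        · have := abs_le.1 (hx2 i)
          simp only at this ⊢
          linarith [this.1, this.2]
      have : fderiv ℝ v x = 0 := by
        by_contra h0
        exact hx' (support_fderiv_subset ℝ h0)
      rw [← ofReal_norm, this, norm_zero, ENNReal.ofReal_zero, zero_pow two_ne_zero]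
      exact zero_le
  have hint2 : ∫⁻ x, ‖fderiv ℝ v x‖ₑ ^ 2
      ≤ ENNReal.ofReal (27 * (4 * (1 + B ^ 2)) * ∫ x in cube, g x) := by
    refine (lintegral_mono hbound).trans ?_
    rw [lintegral_indicator measurableSet_Icc]
    refine (lintegral_box_le (fun x k => by simp only [hgp x k]) (by fun_prop)).trans ?_
    rw [mul_assoc, ← integral_const_mul, ENNReal.ofReal_mul (by norm_num),
      ofReal_integral_eq_lintegral_ofReal (integrableOn_cube (by fun_prop))
        (Eventually.of_forall fun x => by have := hg0 x; positivity)]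
    simp
  have hint6 : ENNReal.ofReal (∫ x in cube, f x ^ 6) ≤ ∫⁻ x, ‖v x‖ₑ ^ 6 := by
    rw [ofReal_integral_eq_lintegral_ofReal (f := fun x => f x ^ 6)
      (integrableOn_cube (hf.continuous.pow 6))
      (Eventually.of_forall fun x => (show Even 6 by decide).pow_nonneg (f x))]
    refine le_trans (setLIntegral_mono' measurableSet_cube fun x hx => ?_)
      (setLIntegral_le_lintegral cube _)
    have hx1 : χ x = 1 := by
      refine χ.one_of_mem_closedBall ?_
      rw [hχin, Metric.mem_closedBall, dist_pi_le_iff (by norm_num)]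
      intro i
      have h1 : 0 ≤ x i := hx.1 i
      have h2 : x i ≤ 1 := hx.2 i
      rw [Real.dist_eq, abs_le]
      constructor <;> linarith
    rw [← ofReal_norm, ← ENNReal.ofReal_pow (norm_nonneg _)]
    simp [hv, hx1, Even.pow_abs (show Even 6 by decide)]
  have hI0 : 0 ≤ ∫ x in cube, g x := integral_nonneg hg0
  refine (ENNReal.ofReal_le_ofReal_iff (by positivity)).1 ?_
  calc ENNReal.ofReal (∫ x in cube, f x ^ 6) ≤ eLpNorm v (6 : ℝ≥0) volume ^ 6 := h6 ▸ hint6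
    _ ≤ (K * eLpNorm (fderiv ℝ v) (2 : ℝ≥0) volume) ^ 6 := by gcongr
    _ = (K : ℝ≥0∞) ^ 6 * (eLpNorm (fderiv ℝ v) (2 : ℝ≥0) volume ^ 2) ^ 3 := by ring
    _ ≤ (K : ℝ≥0∞) ^ 6
        * ENNReal.ofReal (27 * (4 * (1 + B ^ 2)) * ∫ x in cube, g x) ^ 3 := by
          rw [h2]; gcongr
    _ = ENNReal.ofReal ((K : ℝ) ^ 6 * (27 * (4 * (1 + B ^ 2))) ^ 3 * (∫ x in cube, g x) ^ 3) := by
          rw [mul_assoc (_ ^ 6), ← mul_pow, ENNReal.ofReal_mul (p := (K : ℝ) ^ 6) (by positivity),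
            ENNReal.ofReal_pow (by positivity), ENNReal.ofReal_pow (by positivity),
            ENNReal.ofReal_coe_nnreal]

end QNS

/-! ### Higher integrability of the density -/

namespace QNS

/-- Interpolation between `L¹` and the Sobolev bound on `ρ^(γ/2)`, for `ρ = exp L`. -/
theorem exists_interpolation_const : ∃ C : ℝ, 0 ≤ C ∧ ∀ (γ : ℝ) (L : Space → ℝ),
    ContDiff ℝ ∞ L → Periodic L →
    ∫ x in cube, Real.exp (5 * γ / 3 * L x)
      ≤ C * (∫ x in cube, Real.exp (γ * L x)) ^ (2 / 3 : ℝ)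
        * ((∫ x in cube, Real.exp (γ * L x))
          + γ ^ 2 / 4 * ∫ x in cube, Real.exp (γ * L x) * ∑ j, pd j L x ^ 2) := by
  obtain ⟨C, hC, hsob⟩ := exists_sobolev_const
  refine ⟨C ^ (1 / 3 : ℝ), by positivity, fun γ L hL pL => ?_⟩
  have cL := hL.continuous
  have hcont : ∀ c : ℝ, Continuous fun x => Real.exp (c * L x) := fun c => by fun_prop
  have hmem : ∀ (c p : ℝ),
      MemLp (fun x => Real.exp (c * L x)) (ENNReal.ofReal p) (volume.restrict cube) := by
    intro c p
    have : IsFiniteMeasure (volume.restrict cube) := ⟨by simp [volume_cube]⟩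
    obtain ⟨M, hM⟩ := (isCompact_cube.bddAbove_image (hcont c).norm.continuousOn)
    refine MemLp.of_bound (hcont c).aestronglyMeasurable M ?_
    rw [ae_restrict_iff' measurableSet_cube]
    exact Eventually.of_forall fun x hx => hM (Set.mem_image_of_mem _ hx)
  set f : Space → ℝ := fun x => Real.exp (γ / 2 * L x) with hf
  have hfs : ContDiff ℝ ∞ f := (contDiff_const.mul hL).exp
  have hfp : Periodic f := fun x k => by simp only [hf, pL x k]
  have hfd : ∀ j x, pd j f x = Real.exp (γ / 2 * L x) * (γ / 2 * pd j L x) := fun j x =>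
    (HasPD.comp (Real.hasDerivAt_exp _) ((hasPD_of_contDiff hL).const_mul (γ / 2))).2
  have e2 : ∀ x, Real.exp (γ / 2 * L x) ^ 2 = Real.exp (γ * L x) := fun x => by
    rw [← Real.exp_nat_mul]; congr 1; push_cast; ring
  have h6 := hsob f hfs hfp
  have hg : ∫ x in cube, (f x ^ 2 + normSq (grad f x)) = (∫ x in cube, Real.exp (γ * L x))
          + γ ^ 2 / 4 * ∫ x in cube, Real.exp (γ * L x) * ∑ j, pd j L x ^ 2 := by
    rw [← integral_const_mul, ← integral_add (integrableOn_cube (hcont γ))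
      (integrableOn_cube (by fun_prop))]
    refine integral_congr_ae (Eventually.of_forall fun x => ?_)
    simp only [normSq, grad, hfd, Fin.sum_univ_three]
    simp only [hf, ← e2]
    ring
  rw [hg] at h6
  -- Hölder with exponents 3/2 and 3 for ρ^(5γ/3) = ρ^(2γ/3) ρ^γ: the first factor returns ∫ρ^γ, the
  -- second ∫(ρ^(γ/2))⁶, which the Sobolev inequality bounds.
  have hH := integral_mul_le_Lp_mul_Lq_of_nonneg (μ := volume.restrict cube)
    (p := 3 / 2) (q := 3) (f := fun x => Real.exp (2 * γ / 3 * L x))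
    (g := fun x => Real.exp (γ * L x)) (by constructor <;> norm_num)
    (Eventually.of_forall fun x => (Real.exp_pos _).le)
    (Eventually.of_forall fun x => (Real.exp_pos _).le) (hmem _ _) (hmem _ _)
  have r1 : ∀ x, Real.exp (2 * γ / 3 * L x) * Real.exp (γ * L x)
      = Real.exp (5 * γ / 3 * L x) := fun x => by rw [← Real.exp_add]; congr 1; ring
  have r2 : ∀ x, Real.exp (2 * γ / 3 * L x) ^ (3 / 2 : ℝ) = Real.exp (γ * L x) := fun x => by
    rw [← Real.exp_mul]; congr 1; ring
  have r3 : ∀ x, Real.exp (γ * L x) ^ (3 : ℝ) = f x ^ 6 := fun x => by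
    rw [← Real.exp_mul, hf]
    simp only
    rw [← Real.exp_nat_mul]; congr 1; push_cast; ring
  simp only [r1, r2, r3] at hH
  set I := ∫ x in cube, Real.exp (γ * L x) with hI
  set G := I + γ ^ 2 / 4 * ∫ x in cube, Real.exp (γ * L x) * ∑ j, pd j L x ^ 2 with hG
  have hI0 : 0 ≤ I := integral_nonneg fun x => (Real.exp_pos _).le
  have hG0 : 0 ≤ G := by
    have : 0 ≤ ∫ x in cube, Real.exp (γ * L x) * ∑ j, pd j L x ^ 2 :=
      integral_nonneg fun x => mul_nonneg (Real.exp_pos _).le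
        (Finset.sum_nonneg fun j _ => sq_nonneg _)
    positivity
  refine hH.trans ?_
  have h60 : 0 ≤ ∫ x in cube, f x ^ 6 := integral_nonneg fun x =>
    (show Even 6 by decide).pow_nonneg (f x)
  have h6' : (∫ x in cube, f x ^ 6) ^ (1 / 3 : ℝ) ≤ C ^ (1 / 3 : ℝ) * G := by
    refine (Real.rpow_le_rpow h60 h6 (by norm_num)).trans (le_of_eq ?_)
    rw [Real.mul_rpow hC (by positivity), ← Real.rpow_natCast G 3, ← Real.rpow_mul hG0]
    norm_num
  calc I ^ (1 / (3 / 2) : ℝ) * (∫ x in cube, f x ^ 6) ^ (1 / 3 : ℝ)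
      ≤ I ^ (1 / (3 / 2) : ℝ) * (C ^ (1 / 3 : ℝ) * G) := by gcongr
    _ = C ^ (1 / 3 : ℝ) * I ^ (2 / 3 : ℝ) * G := by
      rw [show (1 / (3 / 2) : ℝ) = 2 / 3 by norm_num]; ring

end QNS

/-! ### Pointwise bounds for the entropy production -/

namespace QNS

/-- Put H = 1 + log(1+y). If H ≤ r^(b-a), the left side is at most r^b. Otherwise r is bounded by a
power of H, so r^a H is at most r times a power of H, and any power of a logarithm is dominated by 1
+ y. -/
lemma exists_rpow_mul_log_le {a b : ℝ} (ha : 1 < a) (hab : a < b) :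
    ∃ C : ℝ, 0 ≤ C ∧ ∀ r y : ℝ, 0 < r → 0 ≤ y →
      r ^ a * (1 + Real.log (1 + y)) ≤ r ^ b + C * (r * (1 + y)) := by
  -- With this exponent, r^(b-a) < H gives r^(a-1) ≤ H^k.
  set k := (a - 1) / (b - a) with hk
  have hba : 0 < b - a := sub_pos.2 hab
  have hk0 : 0 < k := div_pos (sub_pos.2 ha) hba
  refine ⟨(k + 2) ^ (k + 1), by positivity, fun r y hr hy => ?_⟩
  have hlog : 0 ≤ Real.log (1 + y) := Real.log_nonneg (by linarith)
  set H := 1 + Real.log (1 + y) with hH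
  have hH1 : 1 ≤ H := by linarith
  have hrest : 0 ≤ (k + 2) ^ (k + 1) * (r * (1 + y)) := by positivity
  rcases le_or_gt H (r ^ (b - a)) with h | h
  · calc r ^ a * H ≤ r ^ a * r ^ (b - a) := by gcongr
      _ = r ^ b := by rw [← Real.rpow_add hr]; congr 1; ring
      _ ≤ _ := le_add_of_nonneg_right hrest
  · have h1 : r ^ (a - 1) ≤ H ^ k := by
      calc r ^ (a - 1) = (r ^ (b - a)) ^ k := by
            rw [← Real.rpow_mul hr.le, hk, mul_div_cancel₀ _ hba.ne']
        _ ≤ H ^ k := Real.rpow_le_rpow (by positivity) h.le hk0.le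
    -- The bound log z ≤ (k+1) z^(1/(k+1)) supplies k + 1, and the summand 1 in H supplies one more;
    -- the root is chosen so that the power k + 1 is linear in 1 + y.
    have h2 : H ≤ (k + 2) * (1 + y) ^ (1 / (k + 1)) := by
      have e1 : Real.log (1 + y) ≤ (1 + y) ^ (1 / (k + 1)) / (1 / (k + 1)) :=
        Real.log_le_rpow_div (by linarith) (by positivity)
      have e2 : 1 ≤ (1 + y) ^ (1 / (k + 1)) :=
        Real.one_le_rpow (by linarith) (by positivity)
      rw [div_div_eq_mul_div, div_one] at e1
      linarith
    have h3 : H ^ (k + 1) ≤ (k + 2) ^ (k + 1) * (1 + y) := by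
      refine (Real.rpow_le_rpow (by linarith) h2 (by linarith)).trans (le_of_eq ?_)
      rw [Real.mul_rpow (by linarith) (by positivity), ← Real.rpow_mul (by linarith),
        one_div_mul_cancel (by linarith), Real.rpow_one]
    calc r ^ a * H = r * (r ^ (a - 1) * H) := by
          rw [← mul_assoc, mul_comm r, ← Real.rpow_add_one hr.ne']; congr 2; ring
      _ ≤ r * (H ^ k * H) := by gcongr
      _ = r * H ^ (k + 1) := by rw [Real.rpow_add_one (by linarith)]
      _ ≤ r * ((k + 2) ^ (k + 1) * (1 + y)) := by gcongr
      _ = (k + 2) ^ (k + 1) * (r * (1 + y)) := by ring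
      _ ≤ _ := le_add_of_nonneg_left (by positivity)

lemma le_mul_log {y : ℝ} (hy : 0 ≤ y) : y ≤ (1 + y) * Real.log (1 + y) := by
  have h := Real.one_sub_inv_le_log_of_pos (show 0 < 1 + y by linarith)
  have h2 : (1 + y) * (1 - (1 + y)⁻¹) = y := by field_simp; ring
  nlinarith [mul_le_mul_of_nonneg_left h (show 0 ≤ 1 + y by linarith)]

section Pointwise

variable (w : Space → Space) (x : Space)

/-- The squared Frobenius norm `|∇w|²`. -/
noncomputable def jacSq : ℝ := ∑ i, ∑ j, jac w x i j ^ 2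

lemma jacSq_nonneg : 0 ≤ jacSq w x :=
  Finset.sum_nonneg fun _ _ => Finset.sum_nonneg fun _ _ => sq_nonneg _

lemma symGrad_sq_le : ∑ i, ∑ j, symGrad w x i j ^ 2 ≤ jacSq w x := by
  simp only [jacSq, symGrad, Fin.sum_univ_three]
  nlinarith [sq_nonneg (jac w x 0 1 - jac w x 1 0), sq_nonneg (jac w x 0 2 - jac w x 2 0),
    sq_nonneg (jac w x 1 2 - jac w x 2 1)]

lemma sum_sq_contract_le (A : Fin 3 → Fin 3 → ℝ) (a : Space) :
    ∑ j, (∑ i, a i * A i j) ^ 2 ≤ normSq a * ∑ i, ∑ j, A i j ^ 2 := by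
  rw [Finset.sum_comm, Finset.mul_sum]
  exact Finset.sum_le_sum fun j _ => Finset.sum_mul_sq_le_sq_mul_sq _ _ _

/-- The sum is the inner product of the contractions of w with Dw and with ∇w. The
arithmetic-geometric inequality splits it, and Cauchy-Schwarz bounds each square by |w|²|∇w|². -/
lemma neg_trilinear_le :
    -(∑ i, ∑ j, ∑ k, symGrad w x i j * w x i * jac w x k j * w x k)
      ≤ normSq (w x) * jacSq w x := by
  have e : ∑ i, ∑ j, ∑ k, symGrad w x i j * w x i * jac w x k j * w x k
      = ∑ j, (∑ i, w x i * symGrad w x i j) * (∑ k, w x k * jac w x k j) := by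
    simp only [Fin.sum_univ_three]; ring
  have h1 := sum_sq_contract_le (symGrad w x) (w x)
  have h2 := sum_sq_contract_le (jac w x) (w x)
  have h3 := mul_le_mul_of_nonneg_left (symGrad_sq_le w x) (normSq_nonneg (w x))
  have h4 : -(∑ j, (∑ i, w x i * symGrad w x i j) * (∑ k, w x k * jac w x k j))
      ≤ ∑ j, (1 / 2 * (∑ i, w x i * symGrad w x i j) ^ 2
        + 1 / 2 * (∑ k, w x k * jac w x k j) ^ 2) := by
    rw [← Finset.sum_neg_distrib]
    exact Finset.sum_le_sum fun j _ => by
      nlinarith [sq_nonneg ((∑ i, w x i * symGrad w x i j) + ∑ k, w x k * jac w x k j)]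
  rw [Finset.sum_add_distrib, ← Finset.mul_sum, ← Finset.mul_sum] at h4
  rw [e]
  simp only [jacSq] at *
  linarith

lemma abs_divergence_le : |divergence w x| ≤ 2 * √(jacSq w x) := by
  refine abs_le_of_sq_le_sq ?_ (by positivity)
  rw [mul_pow, Real.sq_sqrt (jacSq_nonneg w x)]
  have e : divergence w x = jac w x 0 0 + jac w x 1 1 + jac w x 2 2 := by
    simp only [divergence, jac, Fin.sum_univ_three]
  rw [e]
  simp only [jacSq, Fin.sum_univ_three]
  nlinarith [sq_nonneg (jac w x 0 0 - jac w x 1 1), sq_nonneg (jac w x 0 0 - jac w x 2 2),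
    sq_nonneg (jac w x 1 1 - jac w x 2 2), sq_nonneg (jac w x 0 1), sq_nonneg (jac w x 0 2),
    sq_nonneg (jac w x 1 0), sq_nonneg (jac w x 1 2), sq_nonneg (jac w x 2 0),
    sq_nonneg (jac w x 2 1), sq_nonneg (jac w x 0 0)]

lemma abs_quadratic_le :
    |∑ i, ∑ k, w x i * jac w x k i * w x k| ≤ normSq (w x) * √(jacSq w x) := by
  refine abs_le_of_sq_le_sq ?_ (mul_nonneg (normSq_nonneg _) (Real.sqrt_nonneg _))
  rw [mul_pow, Real.sq_sqrt (jacSq_nonneg w x)]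
  have e : ∑ i, ∑ k, w x i * jac w x k i * w x k = ∑ i, w x i * ∑ k, w x k * jac w x k i := by
    simp only [Fin.sum_univ_three]; ring
  rw [e]
  refine (Finset.sum_mul_sq_le_sq_mul_sq _ _ _).trans ?_
  rw [pow_two, mul_assoc]
  exact mul_le_mul_of_nonneg_left (sum_sq_contract_le (jac w x) (w x)) (normSq_nonneg (w x))

end Pointwise

/-- Since |w|² h'' ≤ 2, the trilinear term of unfavourable sign costs only ρ|∇w|² without logarithm,
which the energy controls. The pressure terms are of order ρ^γ|∇w|(1 + log), and Young's inequality
absorbs their gradient into m ρ|∇w|²(1 + log), leaving ρ^(2γ-1)(1 + log). -/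
lemma entropyProduction_log_le {m l γ : ℝ} (hm : 0 < m) (hl : 0 ≤ l) (L : Space → ℝ)
    (w : Space → Space) (x : Space) :
    entropyProduction m l γ (fun y => 1 + Real.log (1 + y)) (fun y => (1 + y)⁻¹) L w x
      ≤ 4 * l * (Real.exp (L x) * jacSq w x)
        + 4 / m * (Real.exp ((2 * γ - 1) * L x) * (1 + logTerm w x)) := by
  have hn := normSq_nonneg (w x)
  have hlog : 0 ≤ logTerm w x := Real.log_nonneg (by linarith)
  have hJ := jacSq_nonneg w x
  have hr := Real.exp_pos (L x)
  have hQ := Real.exp_pos ((γ - 1) * L x)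
  have eP : Real.exp (γ * L x) = Real.exp (L x) * Real.exp ((γ - 1) * L x) :=
    exp_mul_exp_sub_one γ (L x)
  have eQ : Real.exp ((2 * γ - 1) * L x)
      = Real.exp (L x) * Real.exp ((γ - 1) * L x) ^ 2 := by
    rw [← Real.exp_nat_mul, ← Real.exp_add]; congr 1; push_cast; ring
  have hf2 : 0 < (1 + normSq (w x) / 2)⁻¹ := by positivity
  have hnf : normSq (w x) * (1 + normSq (w x) / 2)⁻¹ ≤ 2 := by
    rw [← div_eq_mul_inv, div_le_iff₀ (by linarith)]; linarith
  have hN0 : 0 ≤ √(jacSq w x) := Real.sqrt_nonneg _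
  have hN2 : √(jacSq w x) ^ 2 = jacSq w x := Real.sq_sqrt hJ
  have t2 : 0 ≤ ∑ j, (∑ k, w x k * jac w x k j) ^ 2 :=
    Finset.sum_nonneg fun j _ => sq_nonneg _
  have t3 : 0 ≤ ∑ i, ∑ j, symGrad w x i j ^ 2 :=
    Finset.sum_nonneg fun _ _ => Finset.sum_nonneg fun _ _ => sq_nonneg _
  have t4 := neg_trilinear_le w x
  have t5 := (abs_le.1 (abs_divergence_le w x)).2
  have t6 := (abs_le.1 (abs_quadratic_le w x)).2
  simp only [entropyProduction]
  rw [eP, eQ]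
  rw [show Real.log (1 + normSq (w x) / 2) = logTerm w x from rfl]
  rw [show ∑ i, ∑ j, jac w x i j ^ 2 = jacSq w x from rfl]
  rw [← hN2] at t4 ⊢
  -- From here on only scalar inequalities matter, so the fields are replaced by real numbers.
  generalize √(jacSq w x) = N at *
  generalize (1 + normSq (w x) / 2)⁻¹ = c at *
  generalize normSq (w x) = n at *
  generalize (∑ j, (∑ k, w x k * jac w x k j) ^ 2) = a2 at *
  generalize (∑ i, ∑ j, symGrad w x i j ^ 2) = a3 at *
  generalize (∑ i, ∑ j, ∑ k, symGrad w x i j * w x i * jac w x k j * w x k) = a4 at *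
  generalize (∑ i, ∑ k, w x i * jac w x k i * w x k) = a6 at *
  generalize divergence w x = d at *
  generalize logTerm w x = h at *
  generalize Real.exp ((γ - 1) * L x) = Q at *
  generalize Real.exp (L x) = r at *
  have b2 : 0 ≤ m * (r * a2 * c) := by positivity
  have b3 : 0 ≤ 2 * l * (r * a3 * (1 + h)) := by positivity
  have b4 : -(2 * l * (r * a4 * c)) ≤ 4 * l * (r * N ^ 2) := by
    have : -a4 * c ≤ 2 * N ^ 2 := by
      calc -a4 * c ≤ n * N ^ 2 * c := mul_le_mul_of_nonneg_right t4 hf2.le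
        _ = n * c * N ^ 2 := by ring
        _ ≤ 2 * N ^ 2 := mul_le_mul_of_nonneg_right hnf (sq_nonneg N)
    have := mul_le_mul_of_nonneg_left this (show 0 ≤ 2 * l * r by positivity)
    linarith
  have b6 : a6 * c ≤ 2 * N := by
    calc a6 * c ≤ n * N * c := mul_le_mul_of_nonneg_right t6 hf2.le
      _ = n * c * N := by ring
      _ ≤ 2 * N := mul_le_mul_of_nonneg_right hnf hN0
  have b7 : d * (1 + h) + a6 * c ≤ 4 * N * (1 + h) := by
    have := mul_le_mul_of_nonneg_right t5 (show 0 ≤ 1 + h by linarith)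
    nlinarith [mul_nonneg hN0 hlog]
  have b8 : 4 * Q * N ≤ m * N ^ 2 + 4 / m * Q ^ 2 := by
    have e : m * N ^ 2 + 4 / m * Q ^ 2 - 4 * Q * N = (m * N - 2 * Q) ^ 2 / m := by
      field_simp; ring
    have : 0 ≤ (m * N - 2 * Q) ^ 2 / m := by positivity
    linarith
  have b9 : r * Q * (d * (1 + h) + a6 * c) ≤ r * (1 + h) * (m * N ^ 2 + 4 / m * Q ^ 2) := by
    calc r * Q * (d * (1 + h) + a6 * c) ≤ r * Q * (4 * N * (1 + h)) :=
          mul_le_mul_of_nonneg_left b7 (by positivity)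
      _ = r * (1 + h) * (4 * Q * N) := by ring
      _ ≤ _ := mul_le_mul_of_nonneg_left b8 (by positivity)
  linarith

end QNS

/-! ### Entropy production controlled by energy dissipation -/

namespace QNS

/-- The energy `∫ ρ |w|²/2 + ρ^γ/(γ-1)`. -/
noncomputable def energy (γ : ℝ) (ρ : Space → ℝ) (w : Space → Space) : ℝ :=
  (∫ x in cube, ρ x * (normSq (w x) / 2)) + 1 / (γ - 1) * ∫ x in cube, ρ x ^ γ

/-- The dissipation `∫ ρ |∇w|² + ∫ ρ^γ |∇ log ρ|²`, for `ρ = exp L`. -/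
noncomputable def dissipation (γ : ℝ) (L : Space → ℝ) (w : Space → Space) : ℝ :=
  (∫ x in cube, Real.exp (L x) * jacSq w x)
    + ∫ x in cube, Real.exp (γ * L x) * ∑ j, pd j L x ^ 2

@[fun_prop]
lemma continuous_jacSq {w : Space → Space} (hw : ContDiff ℝ ∞ w) :
    Continuous fun x => jacSq w x := by
  simp only [jacSq]
  fun_prop

lemma dissipation_nonneg (γ : ℝ) (L : Space → ℝ) (w : Space → Space) :
    0 ≤ dissipation γ L w :=
  add_nonneg (integral_nonneg fun x => mul_nonneg (Real.exp_pos _).le (jacSq_nonneg w x))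
    (integral_nonneg fun _ => mul_nonneg (Real.exp_pos _).le
      (Finset.sum_nonneg fun _ _ => sq_nonneg _))

/-- The production of `∫ ρ (1 + |w|²/2) log (1 + |w|²/2)` is controlled by the dissipation,
uniformly on bounded-energy states. -/
lemma exists_integral_production_le {m l γ : ℝ} (hm : 0 < m) (hl : 0 ≤ l) (hγ : 1 < γ)
    (hγ3 : γ < 3) (E₀ : ℝ) :
    ∃ K : ℝ, 0 ≤ K ∧ ∀ (L : Space → ℝ) (w : Space → Space), ContDiff ℝ ∞ L → Periodic L →
      ContDiff ℝ ∞ w → energy γ (fun x => Real.exp (L x)) w ≤ E₀ →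
      ∫ x in cube, entropyProduction m l γ (fun y => 1 + Real.log (1 + y))
        (fun y => (1 + y)⁻¹) L w x ≤ K * (1 + dissipation γ L w) := by
  -- The condition 1 < a is γ > 1, and a < b is γ < 3.
  obtain ⟨C₁, hC₁, hlog⟩ := exists_rpow_mul_log_le (a := 2 * γ - 1) (b := 5 * γ / 3)
    (by linarith) (by linarith)
  obtain ⟨C₂, hC₂, hint⟩ := exists_interpolation_const
  -- The bound on ∫ρ^γ implied by the energy; the maximum keeps it nonnegative for every real `E₀`.
  set M := (γ - 1) * max E₀ 0 with hM
  have hγ1 : 0 < γ - 1 := by linarith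
  have hM0 : 0 ≤ M := mul_nonneg hγ1.le (le_max_right _ _)
  refine ⟨4 * l + 4 / m * (C₂ * M ^ (2 / 3 : ℝ) * (M + γ ^ 2 / 4) + C₁ * (1 + M + max E₀ 0)),
    by positivity, fun L w hL pL hw hE => ?_⟩
  have cL := hL.continuous
  have cw := hw.continuous
  have hexp : ∀ c : ℝ, Continuous fun x => Real.exp (c * L x) := fun c => by fun_prop
  set A := ∫ x in cube, Real.exp (L x) * jacSq w x with hA
  set G := ∫ x in cube, Real.exp (γ * L x) * ∑ j, pd j L x ^ 2 with hG
  set I := ∫ x in cube, Real.exp (γ * L x) with hI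
  set Φ := ∫ x in cube, Real.exp (L x) * (normSq (w x) / 2) with hΦ
  have hA0 : 0 ≤ A := integral_nonneg fun x => mul_nonneg (Real.exp_pos _).le (jacSq_nonneg w x)
  have hG0 : 0 ≤ G := integral_nonneg fun x => mul_nonneg (Real.exp_pos _).le
    (Finset.sum_nonneg fun _ _ => sq_nonneg _)
  have hI0 : 0 ≤ I := integral_nonneg fun x => (Real.exp_pos _).le
  have hΦ0 : 0 ≤ Φ := integral_nonneg fun x => mul_nonneg (Real.exp_pos _).le
    (div_nonneg (normSq_nonneg _) zero_le_two)
  have hE' : Φ + 1 / (γ - 1) * I ≤ E₀ := by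
    have : energy γ (fun x => Real.exp (L x)) w = Φ + 1 / (γ - 1) * I := by
      simp only [energy, ← Real.exp_mul, mul_comm _ γ, hΦ, hI]
    rwa [this] at hE
  have hIq : 0 ≤ 1 / (γ - 1) * I := by positivity
  have hΦE : Φ ≤ max E₀ 0 := le_max_of_le_left (by linarith)
  have hIM : I ≤ M := by
    have h1 : 1 / (γ - 1) * I ≤ max E₀ 0 := le_max_of_le_left (by linarith)
    calc I = (γ - 1) * (1 / (γ - 1) * I) := by field_simp
      _ ≤ M := mul_le_mul_of_nonneg_left h1 hγ1.le
  have hρ : ∫ x in cube, Real.exp (L x) ≤ 1 + M := by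
    calc ∫ x in cube, Real.exp (L x) ≤ ∫ x in cube, (1 + Real.exp (γ * L x)) := by
          refine integral_mono (integrableOn_cube (by fun_prop)) (integrableOn_cube (by fun_prop))
            fun x => ?_
          rcases le_total (L x) 0 with h | h
          · have := Real.exp_le_one_iff.2 h
            have := Real.exp_pos (γ * L x)
            simp only
            linarith
          · have : Real.exp (L x) ≤ Real.exp (γ * L x) := Real.exp_le_exp.2 (by nlinarith)
            simp only
            linarith
      _ = 1 + I := by
          rw [integral_add (integrableOn_cube (by fun_prop)) (integrableOn_cube (by fun_prop))]
          simp [volume_real_cube, hI]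
      _ ≤ 1 + M := by linarith
  have hb := hint γ L hL pL
  have hb' : ∫ x in cube, Real.exp (5 * γ / 3 * L x)
      ≤ C₂ * M ^ (2 / 3 : ℝ) * (M + γ ^ 2 / 4 * G) := hb.trans (by gcongr)
  have hlogint : ∫ x in cube, Real.exp ((2 * γ - 1) * L x) * (1 + logTerm w x)
      ≤ (∫ x in cube, Real.exp (5 * γ / 3 * L x))
        + C₁ * ((∫ x in cube, Real.exp (L x)) + Φ) := by
    rw [hΦ, ← integral_add (integrableOn_cube (by fun_prop)) (integrableOn_cube (by fun_prop)),
      ← integral_const_mul,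
      ← integral_add (integrableOn_cube (by fun_prop)) (integrableOn_cube (by fun_prop))]
    refine integral_mono (integrableOn_cube (by fun_prop)) (integrableOn_cube (by fun_prop))
      fun x => ?_
    have := hlog (Real.exp (L x)) (normSq (w x) / 2) (Real.exp_pos _)
      (div_nonneg (normSq_nonneg _) zero_le_two)
    rw [← Real.exp_mul, ← Real.exp_mul, mul_comm (L x), mul_comm (L x)] at this
    refine this.trans (le_of_eq ?_)
    ring
  have hprod : ∫ x in cube, entropyProduction m l γ (fun y => 1 + Real.log (1 + y))
        (fun y => (1 + y)⁻¹) L w x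
      ≤ 4 * l * A + 4 / m * ∫ x in cube, Real.exp ((2 * γ - 1) * L x) * (1 + logTerm w x) := by
    rw [hA, ← integral_const_mul, ← integral_const_mul,
      ← integral_add (integrableOn_cube (by fun_prop)) (integrableOn_cube (by fun_prop))]
    exact integral_mono
      (integrableOn_cube (continuous_entropyProduction m l γ twiceDiff_mul_log hL hw))
      (integrableOn_cube (by fun_prop)) fun x => entropyProduction_log_le hm hl L w x
  set P := C₂ * M ^ (2 / 3 : ℝ) with hP
  have hP0 : 0 ≤ P := by positivity
  have hmax : 0 ≤ max E₀ 0 := le_max_right _ _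
  have h1 : ∫ x in cube, Real.exp ((2 * γ - 1) * L x) * (1 + logTerm w x)
      ≤ P * (M + γ ^ 2 / 4 * G) + C₁ * (1 + M + max E₀ 0) := by
    refine hlogint.trans (add_le_add hb' (mul_le_mul_of_nonneg_left (by linarith) hC₁))
  have h2 : P * (M + γ ^ 2 / 4 * G) + C₁ * (1 + M + max E₀ 0)
      ≤ (P * (M + γ ^ 2 / 4) + C₁ * (1 + M + max E₀ 0)) * (1 + (A + G)) := by
    have hs : 0 ≤ A + G := add_nonneg hA0 hG0
    have e1 : M + γ ^ 2 / 4 * G ≤ (M + γ ^ 2 / 4) * (1 + (A + G)) := by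
      have : 0 ≤ M * (A + G) := by positivity
      have : 0 ≤ γ ^ 2 / 4 * (1 + A) := by positivity
      linarith
    have e2 := mul_le_mul_of_nonneg_left e1 hP0
    have e3 : 0 ≤ C₁ * (1 + M + max E₀ 0) * (A + G) := by positivity
    linarith
  have h3 := mul_le_mul_of_nonneg_left (h1.trans h2) (show 0 ≤ 4 / m by positivity)
  have h4 : 4 * l * A ≤ 4 * l * (1 + (A + G)) :=
    mul_le_mul_of_nonneg_left (by linarith) (by positivity)
  rw [show dissipation γ L w = A + G from rfl]
  linarith

end QNS

/-! ### Energy decay and growth of the entropy along solutions -/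

namespace QNS

section Solution

variable {ν κ γ T t : ℝ} {ρ : ℝ → Space → ℝ} {u : ℝ → Space → Space}

/-- Energy dissipation. -/
lemma IsSmoothSolution.hasDerivAt_energy_le (hκ : 0 < κ) (hκν : κ < ν) (hγ : 1 < γ)
    (h : IsSmoothSolution ν κ γ T ρ u) (ht : t ∈ Set.Ioo 0 T) :
    ∃ d : ℝ, HasDerivAt (fun s => energy γ (ρ s) (effVel ν κ ρ u s)) d t ∧
      d ≤ -(mu ν κ * dissipation γ (logDensity ρ t) (effVel ν κ ρ u t)) := by
  have ht' : t ∈ Set.Ico 0 T := ⟨ht.1.le, ht.2⟩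
  refine ⟨_, (h.hasDerivAt_entropy hκ hκν ht twiceDiff_id).add
    ((h.hasDerivAt_pressure ht).const_mul (1 / (γ - 1))), ?_⟩
  set L := logDensity ρ t
  set w := effVel ν κ ρ u t
  have hL : ContDiff ℝ ∞ L := h.smooth_log.slice ht'
  have hw : ContDiff ℝ ∞ w := h.slice_effVel ht'
  have cL := hL.continuous
  have hm := mu_pos hκ hκν
  have hl := lam_nonneg ν κ
  have hγ1 : γ - 1 ≠ 0 := by linarith
  have hcp := continuous_entropyProduction (mu ν κ) (lam ν κ) γ twiceDiff_id hL hw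
  rw [← integral_const_mul,
    ← integral_add (integrableOn_cube hcp) (integrableOn_cube (by fun_prop)),
    dissipation, ← integral_add (integrableOn_cube (by fun_prop)) (integrableOn_cube (by fun_prop)),
    ← integral_const_mul, ← integral_neg]
  refine integral_mono (integrableOn_cube (by fun_prop)) (integrableOn_cube (by fun_prop))
    fun x => ?_
  have hS : 0 ≤ ∑ i, ∑ j, symGrad w x i j ^ 2 :=
    Finset.sum_nonneg fun _ _ => Finset.sum_nonneg fun _ _ => sq_nonneg _
  have hG : 0 ≤ ∑ j, pd j L x ^ 2 := Finset.sum_nonneg fun _ _ => sq_nonneg _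
  have hr := Real.exp_pos (L x)
  have hP := Real.exp_pos (γ * L x)
  -- After this normalisation the work term ρ^γ div w cancels against the one in the kinetic energy
  -- balance.
  have e : 1 / (γ - 1) * ((γ - 1) * (-(Real.exp (γ * L x) * divergence w x)
        - mu ν κ * γ * (Real.exp (γ * L x) * ∑ j, pd j L x ^ 2)))
      = -(Real.exp (γ * L x) * divergence w x)
        - mu ν κ * γ * (Real.exp (γ * L x) * ∑ j, pd j L x ^ 2) := by
    rw [← mul_assoc, one_div_mul_cancel hγ1, one_mul]
  simp only [e, entropyProduction, jacSq]
  have b1 : 0 ≤ 2 * lam ν κ * (Real.exp (L x) * ∑ i, ∑ j, symGrad w x i j ^ 2) := by positivity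
  -- The pressure dissipation comes with coefficient μγ; the surplus over μ is discarded.
  have b2 : 0 ≤ (γ - 1) * (mu ν κ * (Real.exp (γ * L x) * ∑ j, pd j L x ^ 2)) :=
    mul_nonneg (by linarith) (by positivity)
  linarith

lemma IsSmoothSolution.continuousOn_entropy (h : IsSmoothSolution ν κ γ T ρ u)
    {f f1 f2 : ℝ → ℝ} (hf : TwiceDiff f f1 f2) :
    ContinuousOn (fun s => ∫ x in cube, ρ s x * f (normSq (effVel ν κ ρ u s x) / 2))
      (Set.Ico 0 T) := by
  refine continuousOn_slab_integral
    (F := fun s x => ρ s x * f (normSq (effVel ν κ ρ u s x) / 2)) ?_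
  have hφ : SlabSmooth T fun s x => normSq (effVel ν κ ρ u s x) / 2 :=
    ContDiffOn.div_const (ContDiffOn.sum fun i _ => (h.smooth_effVel i).pow 2) 2
  exact h.smooth_density.continuousOn.mul
    (hf.continuousOn.comp hφ.continuousOn fun p _ => show (-1 : ℝ) < _ by
      linarith [normSq_nonneg (effVel ν κ ρ u p.1 p.2)])

lemma IsSmoothSolution.continuousOn_energy (h : IsSmoothSolution ν κ γ T ρ u) :
    ContinuousOn (fun s => energy γ (ρ s) (effVel ν κ ρ u s)) (Set.Ico 0 T) := by
  refine (h.continuousOn_entropy twiceDiff_id).add (continuousOn_const.mul ?_)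
  refine continuousOn_slab_integral (F := fun s x => ρ s x ^ γ) ?_
  exact h.smooth_density.continuousOn.rpow_const
    fun p hp => Or.inl (h.density_pos p.1 hp.1 p.2).ne'

lemma antitoneOn_of_hasDerivAt_nonpos {f : ℝ → ℝ} (hf : ContinuousOn f (Set.Ico 0 T))
    (hd : ∀ t ∈ Set.Ioo 0 T, ∃ d, HasDerivAt f d t ∧ d ≤ 0) : AntitoneOn f (Set.Ico 0 T) := by
  refine antitoneOn_of_deriv_nonpos (convex_Ico 0 T) hf ?_ ?_ <;> rw [interior_Ico]
  · intro t ht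
    obtain ⟨d, h, -⟩ := hd t ht
    exact h.differentiableAt.differentiableWithinAt
  · intro t ht
    obtain ⟨d, h, h0⟩ := hd t ht
    rwa [h.deriv]

lemma IsSmoothSolution.energy_le (hκ : 0 < κ) (hκν : κ < ν) (hγ : 1 < γ)
    (h : IsSmoothSolution ν κ γ T ρ u) (ht : t ∈ Set.Ico 0 T) :
    energy γ (ρ t) (effVel ν κ ρ u t) ≤ energy γ (ρ 0) (effVel ν κ ρ u 0) := by
  refine antitoneOn_of_hasDerivAt_nonpos h.continuousOn_energy (fun s hs => ?_)
    ⟨le_rfl, ht.1.trans_lt ht.2⟩ ht ht.1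
  obtain ⟨d, hd, hle⟩ := h.hasDerivAt_energy_le hκ hκν hγ hs
  refine ⟨d, hd, hle.trans (neg_nonpos.2 ?_)⟩
  exact mul_nonneg (mu_pos hκ hκν).le (dissipation_nonneg _ _ _)

lemma mvEntropy_eq (ρ : Space → ℝ) (w : Space → Space) :
    mvEntropy ρ w = ∫ x in cube,
      ρ x * ((1 + normSq (w x) / 2) * Real.log (1 + normSq (w x) / 2)) := by
  simp only [mvEntropy, logTerm, mul_assoc]

lemma IsSmoothSolution.energy_nonneg (hγ : 1 < γ) (h : IsSmoothSolution ν κ γ T ρ u)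
    (ht : t ∈ Set.Ico 0 T) : 0 ≤ energy γ (ρ t) (effVel ν κ ρ u t) :=
  add_nonneg (integral_nonneg fun x => mul_nonneg (h.density_pos t ht x).le
      (div_nonneg (normSq_nonneg _) zero_le_two))
    (mul_nonneg (one_div_nonneg.2 (by linarith))
      (integral_nonneg fun x => Real.rpow_nonneg (h.density_pos t ht x).le _))

/-- Uniform bound of the entropy in terms of the initial data. -/
theorem exists_mvEntropy_bound (hκ : 0 < κ) (hκν : κ < ν) (hγ : 1 < γ) (hγ3 : γ < 3)
    (E₀ : ℝ) : ∃ K : ℝ, 0 ≤ K ∧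
      ∀ (T : ℝ) (ρ : ℝ → Space → ℝ) (u : ℝ → Space → Space), IsSmoothSolution ν κ γ T ρ u →
        energy γ (ρ 0) (effVel ν κ ρ u 0) ≤ E₀ → ∀ t ∈ Set.Ico 0 T,
          mvEntropy (ρ t) (effVel ν κ ρ u t)
            ≤ mvEntropy (ρ 0) (effVel ν κ ρ u 0) + K * (E₀ + t) := by
  have hm := mu_pos hκ hκν
  obtain ⟨K, hK, hprod⟩ := exists_integral_production_le hm (lam_nonneg ν κ) hγ hγ3 E₀
  -- `K` pays for elapsed time, and K/μ for the total dissipation, which is at most the initial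
  -- energy over μ.
  refine ⟨K + K / mu ν κ, by positivity, fun T ρ u h hE t ht => ?_⟩
  have h0 : (0 : ℝ) ∈ Set.Ico 0 T := ⟨le_rfl, ht.1.trans_lt ht.2⟩
  -- The entropy grows at rate at most K(1 + D) while the energy falls at rate at least μD, so
  -- adding K/μ times the energy and subtracting Ks gives a nonincreasing function.
  have hanti : AntitoneOn (fun s => (∫ x in cube, ρ s x *
        ((1 + normSq (effVel ν κ ρ u s x) / 2) * Real.log (1 + normSq (effVel ν κ ρ u s x) / 2)))
      + K / mu ν κ * energy γ (ρ s) (effVel ν κ ρ u s) - K * s) (Set.Ico 0 T) := by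
    refine antitoneOn_of_hasDerivAt_nonpos (((h.continuousOn_entropy twiceDiff_mul_log).add
      (continuousOn_const.mul h.continuousOn_energy)).sub (by fun_prop)) fun s hs => ?_
    have hs' : s ∈ Set.Ico 0 T := ⟨hs.1.le, hs.2⟩
    obtain ⟨d, hd, hdle⟩ := h.hasDerivAt_energy_le hκ hκν hγ hs
    refine ⟨_, (((h.hasDerivAt_entropy hκ hκν hs twiceDiff_mul_log).add
      (hd.const_mul (K / mu ν κ))).sub ((hasDerivAt_id s).const_mul K)), ?_⟩
    have hEs : energy γ (fun x => Real.exp (logDensity ρ s x)) (effVel ν κ ρ u s) ≤ E₀ := by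
      rw [← show ρ s = _ from funext fun x => h.density_eq hs' x]
      exact (h.energy_le hκ hκν hγ hs').trans hE
    have h1 := hprod (logDensity ρ s) (effVel ν κ ρ u s) (h.smooth_log.slice hs')
      (h.periodic_log hs') (h.slice_effVel hs') hEs
    have h2 : K / mu ν κ * d ≤ -(K * dissipation γ (logDensity ρ s) (effVel ν κ ρ u s)) := by
      refine (mul_le_mul_of_nonneg_left hdle (by positivity)).trans (le_of_eq ?_)
      field_simp
    linarith
  have hmono := hanti h0 ht ht.1
  simp only [← mvEntropy_eq, mul_zero, sub_zero] at hmono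
  have e1 : 0 ≤ K / mu ν κ * energy γ (ρ t) (effVel ν κ ρ u t) :=
    mul_nonneg (by positivity) (h.energy_nonneg hγ ht)
  have e2 : K / mu ν κ * energy γ (ρ 0) (effVel ν κ ρ u 0) ≤ K / mu ν κ * E₀ :=
    mul_le_mul_of_nonneg_left hE (by positivity)
  have e3 : 0 ≤ K * E₀ := mul_nonneg hK ((h.energy_nonneg hγ h0).trans hE)
  have e4 : 0 ≤ K / mu ν κ * t := mul_nonneg (by positivity) ht.1
  linarith

/-- The inequality y ≤ (1+y) log(1+y) bounds kinetic energy by entropy, so the initial energy is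
bounded uniformly along the sequence of data. -/
lemma IsSmoothSolution.initial_energy_le (h : IsSmoothSolution ν κ γ T ρ u) (hT : 0 < T) :
    energy γ (ρ 0) (effVel ν κ ρ u 0)
      ≤ mvEntropy (ρ 0) (effVel ν κ ρ u 0) + 1 / (γ - 1) * ∫ x in cube, ρ 0 x ^ γ := by
  have h0 : (0 : ℝ) ∈ Set.Ico 0 T := ⟨le_rfl, hT⟩
  have hw := h.slice_effVel h0
  have cρ : Continuous (ρ 0) := (SlabSmooth.slice h.smooth_density h0).continuous
  refine add_le_add (integral_mono (integrableOn_cube (by fun_prop))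
    (integrableOn_cube (by fun_prop)) fun x => ?_) le_rfl
  simp only [mul_assoc]
  exact mul_le_mul_of_nonneg_left (le_mul_log (div_nonneg (normSq_nonneg _) zero_le_two))
    (h.density_pos 0 h0 x).le

end Solution

end QNS

theorem lemma4p1 (ν κ γ T τ : ℝ) (hκ : 0 < κ) (hκν : κ < ν) (hγ : 1 < γ) (hT : 0 < T)
    (hτ : 0 < τ) :
    (∀ (ρ : ℝ → QNS.Space → ℝ) (u : ℝ → QNS.Space → QNS.Space),
      QNS.IsSmoothSolution ν κ γ T ρ u →
      ∀ t ∈ Set.Ioo 0 T,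
        QNS.MVIdentityAt (QNS.mu ν κ) (QNS.lam ν κ) γ ρ
          (fun s => QNS.effVelocity (QNS.mu ν κ) (ρ s) (u s)) t) ∧
    (γ < 3 →
      ∀ (ρ₀ : ℕ → QNS.Space → ℝ) (u₀ : ℕ → QNS.Space → QNS.Space)
        (ρlim : QNS.Space → ℝ) (ulim : QNS.Space → QNS.Space),
      QNS.InitialDensityHyp γ τ ρ₀ ρlim →
      QNS.InitialVelocityHyp τ ρ₀ u₀ ρlim ulim →
      (∃ M : ℝ, ∀ n,
        QNS.mvEntropy (ρ₀ n) (QNS.effVelocity (QNS.mu ν κ) (ρ₀ n) (u₀ n)) ≤ M) →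
      ∀ (ρ : ℕ → ℝ → QNS.Space → ℝ) (u : ℕ → ℝ → QNS.Space → QNS.Space),
      (∀ n, QNS.IsSmoothSolution ν κ γ T (ρ n) (u n)) →
      (∀ n x, ρ n 0 x = ρ₀ n x) →
      (∀ n x, ρ n 0 x • u n 0 x = ρ₀ n x • u₀ n x) →
      ∃ C : ℝ, 0 < C ∧ ∀ n, ∀ t ∈ Set.Ico 0 T,
        QNS.mvEntropy (ρ n t) (QNS.effVelocity (QNS.mu ν κ) (ρ n t) (u n t)) ≤ C) := by
  refine ⟨fun ρ u h t ht => h.mvIdentity hκ hκν ht, ?_⟩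
  intro hγ3 ρ₀ u₀ ρlim ulim hρ₀ _ ⟨M, hM⟩ ρ u h hρ hu
  obtain ⟨N, hN⟩ := hρ₀.bound_Lγ
  have hγ1 : 0 < 1 / (γ - 1) := one_div_pos.2 (by linarith)
  obtain ⟨K, hK, hbound⟩ := QNS.exists_mvEntropy_bound hκ hκν hγ hγ3 (M + 1 / (γ - 1) * N)
  have e1 : ∀ n, ρ n 0 = ρ₀ n := fun n => funext (hρ n)
  -- The data prescribe the momentum; positivity of the initial density recovers the velocity.
  have e2 : ∀ n, u n 0 = u₀ n := fun n => funext fun x => by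
    have := hu n x
    rw [hρ n x] at this
    exact smul_right_injective _ (hρ₀.pos n x).ne' this
  have hM' : ∀ n, QNS.mvEntropy (ρ n 0) (QNS.effVel ν κ (ρ n) (u n) 0) ≤ M := fun n => by
    rw [QNS.effVel, e1, e2]
    exact hM n
  -- The maximum with 1 only ensures positivity; t < T makes the bound uniform in time.
  refine ⟨max 1 (M + K * ((M + 1 / (γ - 1) * N) + T)), by positivity, fun n t ht => ?_⟩
  refine le_max_of_le_right ?_
  have hE : QNS.energy γ (ρ n 0) (QNS.effVel ν κ (ρ n) (u n) 0) ≤ M + 1 / (γ - 1) * N := by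
    refine ((h n).initial_energy_le hT).trans (add_le_add (hM' n) ?_)
    rw [e1]
    exact mul_le_mul_of_nonneg_left (hN n) hγ1.le
  refine (hbound T (ρ n) (u n) (h n) hE t ht).trans (add_le_add (hM' n) ?_)
  exact mul_le_mul_of_nonneg_left (by linarith [ht.2]) hK
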